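/- Let $G$ be an infinite (discrete) group with a finite symmetric generating set $F$ containing the identity, and let $F^n=\{u_1\cdots u_n : u_i\in F\}$, $F^0=\{e\}$. Assume that $G$ has polynomial growth, and let $d(G)$ be its order of growth, i.e. the least degree of a polynomial $q$ with $|F^n|\le q(n)$ for all $n$. Let $f$ be a real polynomial of degree $d(G)$ and $0<\lambda\le 1$ a constant with $$\lambda f(n)\le |F^n|\le f(n)\qquad (n=0,1,2,\dots).$$ Let $\tau(x)=\min\{n\ge 0: x\in F^n\}$ be the word length, let $\beta\ge 0$ and $\omega_\beta(x)=(1+\tau(x))^\beta$, let $\ell^1(G,\omega_\beta)$ be the convolution algebra of all $g:G\to\mathbb C$ with $\|g\|=\sum_{x\in G}|g(x)|\,\omega_\beta(x)<\infty$, and let $Z\ell^1(G,\omega_\beta)$ be its algebraic centre. Suppose that one of the following holds: (i) $\lambda=1$ and $\beta>\frac{d(G)}{2}$; (ii) $0<\lambda<1$ and $\beta>\frac{d(G)+1}{2}$. Then $Z\ell^1(G,\omega_\beta)$ is isomorphic to a $Q$-algebra, i.e. there is an algebra isomorphism, bounded with bounded inverse, from it onto a quotient of a uniform algebra (a closed point-separating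 subalgebra of $C(K)$, $K$ compact Hausdorff, containing the constants) by a closed ideal. Moreover the series below converges, and $Z\ell^1(G,\omega_\beta)$ satisfies the multi-variable $(\delta,1)$-von Neumann inequality with $$\delta = e^{-1}\left(1+K_G\,\max\{1,2^{\beta-1}\}\left[1+\sum_{n=1}^\infty \frac{f(n)-\lambda f(n-1)}{(1+n)^{2\beta}}\right]^{1/2}\right)^{-1},$$ where $K_G$ is the complex Grothendieck constant; that is, for all $n$, all $a_1,\dots,a_n\in Z\ell^1(G,\omega_\beta)$ with $\|a_i\|\le\delta$ and every complex polynomial $p$ in $n$ variables without constant term, $$\|p(a_1,\dots,a_n)\|\le \sup\{|p(z_1,\dots,z_n)| : |z_i|\le 1\}.$$ -/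

import Mathlib

open scoped Pointwise

noncomputable section

universe u

/-! ### Finite symmetric generating sets, word length, growth -/

/-- A finite symmetric generating set of `G` containing the identity. -/
structure SymmGenSet (G : Type u) [Group G] where
  carrier : Finset G
  one_mem : (1 : G) ∈ carrier
  inv_mem : ∀ x ∈ carrier, x⁻¹ ∈ carrier
  closure_eq_top : Subgroup.closure (carrier : Set G) = ⊤

namespace SymmGenSet

variable {G : Type u} [Group G] (F : SymmGenSet G)

/-- `F ^ n = {u₁ ⋯ uₙ : uᵢ ∈ F}`, with `F ^ 0 = {1}`. -/
def ball (n : ℕ) : Set G := (F.carrier : Set G) ^ n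

/-- The word length `τ_F(x) = min {n : x ∈ F ^ n}`; as `F ^ 0 = {1}`, the identity has length `0`. -/
def length (x : G) : ℕ := sInf {n : ℕ | x ∈ F.ball n}

/-- The order of growth `d(G)`: the least degree of a real polynomial `p` with `|F ^ n| ≤ p(n)` for
all `n`. -/
def growthOrder : ℕ :=
  sInf {d : ℕ | ∃ p : Polynomial ℝ, p.natDegree = d ∧ ∀ n : ℕ, ((F.ball n).ncard : ℝ) ≤ p.eval (n : ℝ)}

/-- `f` is a polynomial of degree `d(G)` and `0 < lam ≤ 1` is a constant with
`lam * f(n) ≤ |F ^ n| ≤ f(n)` for all `n`. -/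
structure IsGrowthPair (f : Polynomial ℝ) (lam : ℝ) : Prop where
  pos : 0 < lam
  le_one : lam ≤ 1
  natDegree_eq : f.natDegree = F.growthOrder
  lower : ∀ n : ℕ, lam * f.eval (n : ℝ) ≤ ((F.ball n).ncard : ℝ)
  upper : ∀ n : ℕ, ((F.ball n).ncard : ℝ) ≤ f.eval (n : ℝ)

theorem mul_mem_ball {m n : ℕ} {x y : G} (hx : x ∈ F.ball m) (hy : y ∈ F.ball n) :
    x * y ∈ F.ball (m + n) := by
  unfold ball at *
  rw [pow_add]
  exact Set.mul_mem_mul hx hy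

theorem inv_mem_ball {n : ℕ} {x : G} (hx : x ∈ F.ball n) : x⁻¹ ∈ F.ball n := by
  have h : ((F.carrier : Set G))⁻¹ = (F.carrier : Set G) := by
    ext y
    constructor
    · intro hy
      have := F.inv_mem _ (Finset.mem_coe.1 (Set.mem_inv.1 hy))
      simpa using this
    · intro hy
      exact Set.mem_inv.2 (Finset.mem_coe.2 (F.inv_mem _ (Finset.mem_coe.1 hy)))
  unfold ball at *
  rw [← h, inv_pow, Set.mem_inv, inv_inv]
  exact hx

theorem exists_mem_ball (x : G) : ∃ n, x ∈ F.ball n := by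
  have hx : x ∈ Subgroup.closure (F.carrier : Set G) := by
    rw [F.closure_eq_top]; trivial
  induction hx using Subgroup.closure_induction with
  | mem y hy => exact ⟨1, by simpa [ball] using hy⟩
  | one => exact ⟨0, by simp [ball]⟩
  | mul y z _ _ hy hz =>
    obtain ⟨m, hm⟩ := hy
    obtain ⟨n, hn⟩ := hz
    exact ⟨m + n, F.mul_mem_ball hm hn⟩
  | inv y _ hy =>
    obtain ⟨m, hm⟩ := hy
    exact ⟨m, F.inv_mem_ball hm⟩

theorem mem_ball_length (x : G) : x ∈ F.ball (F.length x) :=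
  Nat.sInf_mem (F.exists_mem_ball x)

theorem length_mul_le (x y : G) : F.length (x * y) ≤ F.length x + F.length y :=
  Nat.sInf_le (F.mul_mem_ball (F.mem_ball_length x) (F.mem_ball_length y))

end SymmGenSet

/-! ### Weights and weighted group algebras -/

/-- A weight on `G`: a function `ω : G → (0, ∞)` with `ω(xy) ≤ ω(x) ω(y)`. -/
structure GroupWeight (G : Type u) [Group G] where
  toFun : G → ℝ
  pos : ∀ x, 0 < toFun x
  mul_le : ∀ x y, toFun (x * y) ≤ toFun x * toFun y

/-- The polynomial weight `ω_β(x) = (1 + τ(x)) ^ β`. -/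
def SymmGenSet.polyWeight {G : Type u} [Group G] (F : SymmGenSet G) (β : ℝ) (hβ : 0 ≤ β) :
    GroupWeight G where
  toFun x := (1 + (F.length x : ℝ)) ^ β
  pos x := by positivity
  mul_le x y := by
    rw [← Real.mul_rpow (by positivity) (by positivity)]
    refine Real.rpow_le_rpow (by positivity) ?_ hβ
    have h : (F.length (x * y) : ℝ) ≤ F.length x + F.length y := by
      exact_mod_cast F.length_mul_le x y
    have h2 : (0 : ℝ) ≤ (F.length x : ℝ) * F.length y := by positivity
    nlinarith

section WeightedL1

variable {G : Type u} [Group G]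

/-- The functions `f : G → ℂ` with `∑ |f(x)| ω(x) < ∞`. -/
def weightedL1Submodule (ω : GroupWeight G) : Submodule ℂ (G → ℂ) where
  carrier := {f | Summable fun x => ‖f x‖ * ω.toFun x}
  zero_mem' := by simp
  add_mem' := by
    intro f g hf hg
    refine Summable.of_nonneg_of_le (fun x => mul_nonneg (norm_nonneg _) (ω.pos x).le) (fun x => ?_)
      (hf.add hg)
    rw [← add_mul]
    exact mul_le_mul_of_nonneg_right (norm_add_le _ _) (ω.pos x).le
  smul_mem' := by
    intro c f hf
    have h := Summable.mul_left ‖c‖ hf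
    simpa [mul_assoc] using h

/-- The weighted group algebra `ℓ¹(G, ω)`. -/
def WeightedL1 (ω : GroupWeight G) : Type u := ↥(weightedL1Submodule ω)

namespace WeightedL1

variable {ω : GroupWeight G}

instance : AddCommGroup (WeightedL1 ω) := inferInstanceAs (AddCommGroup ↥(weightedL1Submodule ω))

instance : Module ℂ (WeightedL1 ω) := inferInstanceAs (Module ℂ ↥(weightedL1Submodule ω))

instance : CoeFun (WeightedL1 ω) (fun _ => G → ℂ) := ⟨fun f => f.1⟩

@[ext] theorem ext {f g : WeightedL1 ω} (h : ∀ x, f x = g x) : f = g := Subtype.ext (funext h)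

theorem summable (f : WeightedL1 ω) : Summable fun x => ‖f x‖ * ω.toFun x := f.2

@[simp] theorem add_apply (f g : WeightedL1 ω) (x : G) : (f + g) x = f x + g x := rfl
@[simp] theorem neg_apply (f : WeightedL1 ω) (x : G) : (-f) x = -f x := rfl
@[simp] theorem zero_apply (x : G) : (0 : WeightedL1 ω) x = 0 := rfl
@[simp] theorem smul_apply (c : ℂ) (f : WeightedL1 ω) (x : G) : (c • f) x = c * f x := rfl

/-- `‖f‖ = ∑ |f(x)| ω(x)`. -/
instance : Norm (WeightedL1 ω) := ⟨fun f => ∑' x, ‖f x‖ * ω.toFun x⟩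

theorem norm_def (f : WeightedL1 ω) : ‖f‖ = ∑' x, ‖f x‖ * ω.toFun x := rfl

theorem term_nonneg (f : WeightedL1 ω) (x : G) : 0 ≤ ‖f x‖ * ω.toFun x :=
  mul_nonneg (norm_nonneg _) (ω.pos x).le

theorem norm_apply_mul_le (f : WeightedL1 ω) (x : G) : ‖f x‖ * ω.toFun x ≤ ‖f‖ :=
  f.summable.le_tsum x (fun y _ => f.term_nonneg y)

instance : NormedAddCommGroup (WeightedL1 ω) :=
  AddGroupNorm.toNormedAddCommGroup
    { toFun := fun f => ‖f‖
      map_zero' := by simp [norm_def]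
      add_le' := fun f g => by
        rw [norm_def, norm_def, norm_def, ← f.summable.tsum_add g.summable]
        refine Summable.tsum_le_tsum (fun x => ?_) (f + g).summable (f.summable.add g.summable)
        rw [← add_mul]
        exact mul_le_mul_of_nonneg_right (norm_add_le _ _) (ω.pos x).le
      neg' := fun f => by simp [norm_def]
      eq_zero_of_map_eq_zero' := fun f hf => by
        ext x
        have h := f.norm_apply_mul_le x
        have hf' : ‖f‖ = 0 := hf
        rw [hf'] at h
        have h0 := le_antisymm h (f.term_nonneg x)
        rcases mul_eq_zero.1 h0 with h1 | h1
        · simpa using h1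
        · exact absurd h1 (ω.pos x).ne' }

/-- The terms `f(y) g(y⁻¹x)` are absolutely summable over all pairs, even with weight `ω(x)`. -/
theorem summable_pair (f g : WeightedL1 ω) :
    Summable fun p : G × G => ‖f p.1‖ * ‖g (p.1⁻¹ * p.2)‖ * ω.toFun p.2 := by
  let e : G × G ≃ G × G :=
    { toFun := fun p => (p.1, p.1⁻¹ * p.2)
      invFun := fun p => (p.1, p.1 * p.2)
      left_inv := fun p => by simp
      right_inv := fun p => by simp }
  have h := f.summable.mul_of_nonneg g.summable f.term_nonneg g.term_nonneg
  rw [← e.summable_iff] at h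
  refine Summable.of_nonneg_of_le
    (fun p => mul_nonneg (mul_nonneg (norm_nonneg _) (norm_nonneg _)) (ω.pos _).le) (fun p => ?_) h
  have h1 := ω.mul_le p.1 (p.1⁻¹ * p.2)
  rw [mul_inv_cancel_left] at h1
  have h2 := mul_le_mul_of_nonneg_left h1
    (mul_nonneg (norm_nonneg (f p.1)) (norm_nonneg (g (p.1⁻¹ * p.2))))
  simp only [Function.comp, e, Equiv.coe_fn_mk]
  calc _ ≤ _ := h2
    _ = _ := by ring

theorem tsum_pair_le (f g : WeightedL1 ω) :
    ∑' p : G × G, ‖f p.1‖ * ‖g (p.1⁻¹ * p.2)‖ * ω.toFun p.2 ≤ ‖f‖ * ‖g‖ := by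
  let e : G × G ≃ G × G :=
    { toFun := fun p => (p.1, p.1⁻¹ * p.2)
      invFun := fun p => (p.1, p.1 * p.2)
      left_inv := fun p => by simp
      right_inv := fun p => by simp }
  have h := f.summable.mul_of_nonneg g.summable f.term_nonneg g.term_nonneg
  rw [norm_def, norm_def, f.summable.tsum_mul_tsum g.summable h,
    ← e.tsum_eq (fun q : G × G => ‖f q.1‖ * ω.toFun q.1 * (‖g q.2‖ * ω.toFun q.2))]
  refine Summable.tsum_le_tsum (fun p => ?_) (summable_pair f g) ((e.summable_iff).2 h)
  have h1 := ω.mul_le p.1 (p.1⁻¹ * p.2)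
  rw [mul_inv_cancel_left] at h1
  have h2 := mul_le_mul_of_nonneg_left h1
    (mul_nonneg (norm_nonneg (f p.1)) (norm_nonneg (g (p.1⁻¹ * p.2))))
  simp only [e, Equiv.coe_fn_mk]
  calc _ ≤ _ := h2
    _ = _ := by ring

theorem summable_swap (f g : WeightedL1 ω) :
    Summable fun p : G × G => ‖f p.2‖ * ‖g (p.2⁻¹ * p.1)‖ * ω.toFun p.1 :=
  (Equiv.prodComm G G).summable_iff.2 (summable_pair f g)

theorem summable_conv_norm (f g : WeightedL1 ω) (x : G) :
    Summable fun y => ‖f y * g (y⁻¹ * x)‖ := by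
  have h := (summable_swap f g).prod_factor x
  simp only at h
  rw [summable_mul_right_iff (ω.pos x).ne'] at h
  simpa using h

theorem summable_conv (f g : WeightedL1 ω) (x : G) : Summable fun y => f y * g (y⁻¹ * x) :=
  (summable_conv_norm f g x).of_norm

theorem norm_conv_le (f g : WeightedL1 ω) (x : G) :
    ‖∑' y, f y * g (y⁻¹ * x)‖ * ω.toFun x ≤ ∑' y, ‖f y‖ * ‖g (y⁻¹ * x)‖ * ω.toFun x := by
  rw [tsum_mul_right]
  refine mul_le_mul_of_nonneg_right ?_ (ω.pos x).le
  have h := norm_tsum_le_tsum_norm (summable_conv_norm f g x)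
  simpa using h

theorem summable_conv_weight (f g : WeightedL1 ω) :
    Summable fun x => ‖∑' y, f y * g (y⁻¹ * x)‖ * ω.toFun x :=
  Summable.of_nonneg_of_le (fun x => mul_nonneg (norm_nonneg _) (ω.pos x).le)
    (fun x => norm_conv_le f g x) (summable_swap f g).prod

/-- Convolution: `(f * g)(x) = ∑_y f(y) g(y⁻¹x)`. -/
instance : Mul (WeightedL1 ω) :=
  ⟨fun f g => ⟨fun x => ∑' y, f y * g (y⁻¹ * x), summable_conv_weight f g⟩⟩

theorem mul_apply (f g : WeightedL1 ω) (x : G) : (f * g) x = ∑' y, f y * g (y⁻¹ * x) := rfl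

open Classical in
/-- The unit is the point mass at the identity. -/
instance : One (WeightedL1 ω) :=
  ⟨⟨fun x => if x = 1 then 1 else 0,
    summable_of_ne_finset_zero (s := {1}) (fun x hx => by
      have : x ≠ 1 := by simpa using hx
      simp [this])⟩⟩

open Classical in
theorem one_apply (x : G) : (1 : WeightedL1 ω) x = if x = 1 then 1 else 0 := rfl

theorem one_mul' (f : WeightedL1 ω) : 1 * f = f := by
  ext x
  rw [mul_apply, tsum_eq_single 1]
  · simp [one_apply]
  · intro y hy
    simp [one_apply, hy]

theorem mul_one' (f : WeightedL1 ω) : f * 1 = f := by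
  ext x
  rw [mul_apply, tsum_eq_single x]
  · simp [one_apply]
  · intro y hy
    have : y⁻¹ * x ≠ 1 := fun h => hy (inv_mul_eq_one.1 h)
    simp [one_apply, this]

theorem left_distrib' (f g h : WeightedL1 ω) : f * (g + h) = f * g + f * h := by
  ext x
  rw [add_apply, mul_apply, mul_apply, mul_apply,
    ← (summable_conv f g x).tsum_add (summable_conv f h x)]
  exact tsum_congr fun y => by rw [add_apply, mul_add]

theorem right_distrib' (f g h : WeightedL1 ω) : (f + g) * h = f * h + g * h := by
  ext x
  rw [add_apply, mul_apply, mul_apply, mul_apply,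
    ← (summable_conv f h x).tsum_add (summable_conv g h x)]
  exact tsum_congr fun y => by rw [add_apply, add_mul]

theorem smul_mul' (c : ℂ) (f g : WeightedL1 ω) : c • f * g = c • (f * g) := by
  ext x
  rw [smul_apply, mul_apply, mul_apply, ← tsum_mul_left]
  exact tsum_congr fun y => by rw [smul_apply, mul_assoc]

theorem mul_smul' (c : ℂ) (f g : WeightedL1 ω) : f * c • g = c • (f * g) := by
  ext x
  rw [smul_apply, mul_apply, mul_apply, ← tsum_mul_left]
  exact tsum_congr fun y => by rw [smul_apply, mul_left_comm]

theorem mul_assoc' (f g h : WeightedL1 ω) : f * g * h = f * (g * h) := by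
  ext x
  have key : Summable fun p : G × G => f p.1 * g (p.1⁻¹ * p.2) * h (p.2⁻¹ * x) := by
    refine Summable.of_norm_bounded ((summable_pair f g).mul_right (‖h‖ / ω.toFun x)) (fun p => ?_)
    have h1 := h.norm_apply_mul_le (p.2⁻¹ * x)
    have h2 := ω.mul_le p.2 (p.2⁻¹ * x)
    rw [mul_inv_cancel_left] at h2
    have h3 : ‖h (p.2⁻¹ * x)‖ ≤ ω.toFun p.2 * (‖h‖ / ω.toFun x) := by
      rw [← mul_div_assoc, le_div_iff₀ (ω.pos x)]
      calc ‖h (p.2⁻¹ * x)‖ * ω.toFun x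
          ≤ ‖h (p.2⁻¹ * x)‖ * (ω.toFun p.2 * ω.toFun (p.2⁻¹ * x)) :=
            mul_le_mul_of_nonneg_left h2 (norm_nonneg _)
        _ = ω.toFun p.2 * (‖h (p.2⁻¹ * x)‖ * ω.toFun (p.2⁻¹ * x)) := by ring
        _ ≤ ω.toFun p.2 * ‖h‖ := mul_le_mul_of_nonneg_left h1 (ω.pos _).le
    rw [norm_mul, norm_mul, mul_assoc (‖f p.1‖ * _)]
    exact mul_le_mul_of_nonneg_left h3 (mul_nonneg (norm_nonneg _) (norm_nonneg _))
  calc (f * g * h) x = ∑' z, ∑' y, f y * g (y⁻¹ * z) * h (z⁻¹ * x) := by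
        rw [mul_apply]
        exact tsum_congr fun z => by rw [mul_apply, tsum_mul_right]
    _ = ∑' y, ∑' z, f y * g (y⁻¹ * z) * h (z⁻¹ * x) :=
        Summable.tsum_comm (f := fun y z => f y * g (y⁻¹ * z) * h (z⁻¹ * x)) key
    _ = (f * (g * h)) x := by
        rw [mul_apply]
        refine tsum_congr fun y => ?_
        rw [mul_apply, ← tsum_mul_left,
          ← (Equiv.mulLeft y⁻¹).tsum_eq (fun w => f y * (g w * h (w⁻¹ * (y⁻¹ * x))))]
        refine tsum_congr fun z => ?_
        simp [mul_assoc]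

theorem norm_mul_le' (f g : WeightedL1 ω) : ‖f * g‖ ≤ ‖f‖ * ‖g‖ := by
  refine le_trans ?_ (tsum_pair_le f g)
  rw [← (Equiv.prodComm G G).tsum_eq]
  have hs := summable_swap f g
  calc ‖f * g‖ ≤ ∑' x, ∑' y, ‖f y‖ * ‖g (y⁻¹ * x)‖ * ω.toFun x :=
        Summable.tsum_le_tsum (fun x => norm_conv_le f g x) (f * g).summable hs.prod
    _ = _ := (hs.tsum_prod).symm

instance : NormedRing (WeightedL1 ω) where
  __ := (inferInstance : NormedAddCommGroup (WeightedL1 ω))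
  mul_assoc := mul_assoc'
  one_mul := one_mul'
  mul_one := mul_one'
  left_distrib := left_distrib'
  right_distrib := right_distrib'
  zero_mul f := by ext x; simp [mul_apply]
  mul_zero f := by ext x; simp [mul_apply]
  norm_mul_le := norm_mul_le'

instance : Algebra ℂ (WeightedL1 ω) := Algebra.ofModule smul_mul' (fun c f g => mul_smul' c f g)

instance : NormedAlgebra ℂ (WeightedL1 ω) where
  norm_smul_le c f := by
    rw [norm_def, norm_def, ← tsum_mul_left]
    refine le_of_eq (tsum_congr fun x => ?_)
    rw [smul_apply, norm_mul, mul_assoc]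

end WeightedL1

end WeightedL1

/-! ### The algebraic centre, von Neumann inequalities, `Q`-algebras -/

/-- The algebraic centre `ZA` of an algebra `A`, with the norm of `A`. -/
abbrev AlgCenter (A : Type u) [NormedRing A] [NormedAlgebra ℂ A] : Type u :=
  ↥(Subalgebra.center ℂ A)

instance AlgCenter.normedCommRing (A : Type u) [NormedRing A] [NormedAlgebra ℂ A] :
    NormedCommRing (AlgCenter A) where
  __ := (inferInstance : NormedRing (AlgCenter A))
  __ := (inferInstance : CommRing (AlgCenter A))

/-- `‖p‖_∞ = sup {|p(z₁, …, zₙ)| : |zᵢ| ≤ 1}` for a complex polynomial in `n` variables. -/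
def polydiscNorm {n : ℕ} (p : MvPolynomial (Fin n) ℂ) : ℝ :=
  sSup {r : ℝ | ∃ z : Fin n → ℂ, (∀ i, ‖z i‖ ≤ 1) ∧ r = ‖MvPolynomial.eval z p‖}

/-- The multi-variable `(δ, L)`-von Neumann inequality: `‖p(a₁, …, aₙ)‖ ≤ L ‖p‖_∞` for all
`a₁, …, aₙ` of norm at most `δ` and all polynomials `p` without constant term. -/
def SatisfiesVonNeumannInequality (A : Type u) [NormedCommRing A] [NormedAlgebra ℂ A] (δ L : ℝ) :
    Prop :=
  ∀ (n : ℕ) (a : Fin n → A), (∀ i, ‖a i‖ ≤ δ) →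
    ∀ p : MvPolynomial (Fin n) ℂ, MvPolynomial.constantCoeff p = 0 →
      ‖MvPolynomial.aeval a p‖ ≤ L * polydiscNorm p

/-- A uniform algebra on a compact Hausdorff space `K`: a closed subalgebra of `C(K)` which contains
the constants (part of `Subalgebra`) and separates the points of `K`. -/
structure IsUniformAlgebra {K : Type u} [TopologicalSpace K] [CompactSpace K] [T2Space K]
    (U : Subalgebra ℂ C(K, ℂ)) : Prop where
  isClosed : IsClosed (U : Set C(K, ℂ))
  separatesPoints : U.SeparatesPoints

/-- `A` is isomorphic, as a Banach algebra, to a quotient of `B` by a closed ideal: there is an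
algebra isomorphism of `A` onto some `B ⧸ J` (with the quotient norm), `J` a closed ideal, which is
bounded with bounded inverse. -/
def IsIsomorphicToQuotientOf (A : Type u) [NormedCommRing A] [NormedAlgebra ℂ A]
    (B : Type u) [NormedCommRing B] [NormedAlgebra ℂ B] : Prop :=
  ∃ J : Ideal B, IsClosed (J : Set B) ∧
    ∃ (e : A ≃ₐ[ℂ] (B ⧸ J)) (C : ℝ), ∀ a : A, ‖e a‖ ≤ C * ‖a‖ ∧ ‖a‖ ≤ C * ‖e a‖

/-- `A` is isomorphic to a `Q`-algebra, i.e. to a quotient of a uniform algebra by a closed ideal. -/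
def IsIsomorphicToQAlgebra (A : Type u) [NormedCommRing A] [NormedAlgebra ℂ A] : Prop :=
  ∃ (K : Type u) (_ : TopologicalSpace K) (_ : CompactSpace K) (_ : T2Space K)
    (U : Subalgebra ℂ C(K, ℂ)), IsUniformAlgebra U ∧ IsIsomorphicToQuotientOf A U

/-! ### Grothendieck's constant -/

/-- `K` is admissible in the complex Grothendieck inequality: for every complex `m × n` matrix whose
bilinear form is bounded by `1` on the unit polydiscs, the corresponding form on vectors of norm at
most `1` of a (without loss of generality finite-dimensional) complex Hilbert space is bounded
by `K`. -/
def IsGrothendieckBound (K : ℝ) : Prop :=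
  ∀ (m n : ℕ) (a : Matrix (Fin m) (Fin n) ℂ),
    (∀ (s : Fin m → ℂ) (t : Fin n → ℂ), (∀ i, ‖s i‖ ≤ 1) → (∀ j, ‖t j‖ ≤ 1) →
      ‖∑ i, ∑ j, a i j * s i * t j‖ ≤ 1) →
    ∀ (k : ℕ) (x : Fin m → EuclideanSpace ℂ (Fin k)) (y : Fin n → EuclideanSpace ℂ (Fin k)),
      (∀ i, ‖x i‖ ≤ 1) → (∀ j, ‖y j‖ ≤ 1) →
      ‖∑ i, ∑ j, a i j * inner ℂ (x i) (y j)‖ ≤ K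

/-- The (complex) Grothendieck constant `K_G`. -/
def grothendieckConstant : ℝ := sInf {K : ℝ | IsGrothendieckBound K}

/-! ### The constants of the polynomial weight -/

/-- The `n`-th term, `n = 0, 1, …`, of the series `∑_{n ≥ 1} (f(n) - lam f(n-1)) / (1+n)^{2β}`,
shifted by one. -/
def growthTerm (f : Polynomial ℝ) (lam β : ℝ) (n : ℕ) : ℝ :=
  (f.eval ((n : ℝ) + 1) - lam * f.eval (n : ℝ)) / (1 + ((n : ℝ) + 1)) ^ (2 * β)

/-- `δ = e⁻¹ (1 + K_G max{1, 2^{β-1}} [1 + ∑_{n ≥ 1} (f(n) - lam f(n-1)) / (1+n)^{2β}]^{1/2})⁻¹`. -/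
def polyDelta (f : Polynomial ℝ) (lam β : ℝ) : ℝ :=
  (Real.exp 1)⁻¹ *
    (1 + grothendieckConstant * max 1 ((2 : ℝ) ^ (β - 1)) *
      Real.sqrt (1 + ∑' n : ℕ, growthTerm f lam β n))⁻¹

end

/-!
The theorem rests on one estimate: the multiplication of `ℓ¹(G, ω_β)` is bounded for the injective
tensor norm, with constant `2 C`, where `C = K_G max{1, 2^(β-1)} S` and `S²` bounds `∑ ω_β(x)⁻²`.

The estimate (`WeightedL1.isInjectiveMulBound`) comes from the inequality
`ω(xy) ≤ max{1, 2^(β-1)} (ω(x) + ω(y))`. It splits the normalized kernel `ω(xy) / (ω(x) ω(y))` into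
a part whose columns lie in `ℓ²` with norm at most `max{1, 2^(β-1)} S` and a part whose rows do.
After testing against a bounded function, both parts are matrices of inner products of Hilbert space
vectors, and Grothendieck's inequality applies to each, whence the factor `2`. That `K_G` is
an admissible constant, and not the infimum of an empty set, requires a proof of Grothendieck's
inequality with some constant (`isGrothendieckBound_explicit`); it is obtained by truncating
Rademacher sums. The bound on `∑ ω_β(x)⁻²` by the series is a summation over spheres
(`SymmGenSet.IsGrowthPair.sum_inv_polyWeight_sq_le`).

A bound for the injective tensor norm yields a von Neumann inequality
(`IsInjectiveMulBound.satisfiesVonNeumannInequality`). A homogeneous polynomial is evaluated with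
Euler's identity `m p = ∑ z_j ∂_j p`, which detaches one factor at a time; every step costs the
injective bound `2 C` and the growth of `p` under differentiation. On the polydisc, a Schwarz-Pick
argument shows that differentiation of a polynomial of degree `m` costs at most `m e / 2`
(`MvPolynomial.IsHomogeneous.norm_sum_mul_eval_pderiv_le`). This `e / 2`, instead of the constant `e`
of the general polarization inequality, absorbs the factor `2`, so that the homogeneous components
are dominated by a geometric series with ratio `C / (1 + C)`.

Finally, a complete commutative algebra with a von Neumann inequality is isomorphic to a `Q`-algebra
(`SatisfiesVonNeumannInequality.isIsomorphicToQAlgebra`): the evaluation of polynomials at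
the elements of a ball extends to the uniform closure of the polynomials on a polydisc with one
coordinate for each element of that ball.
-/

/-! ### Grothendieck's inequality -/

/-- Rademacher averages: `ℂᵏ` embeds isometrically into `L²` of a finite uniform probability space
in such a way that the fourth moment is controlled by the second one. -/
theorem exists_rademacher_embedding (k : ℕ) :
    ∃ (N : ℕ) (_ : 0 < N) (R : (Fin k → ℂ) → Fin N → ℂ),
      (∀ x y, ∑ w, (starRingEnd ℂ) (R x w) * R y w = N * ∑ l, (starRingEnd ℂ) (x l) * y l) ∧
      (∀ x, ∑ w, ‖R x w‖ ^ 4 ≤ N * (3 * (∑ l, ‖x l‖ ^ 2) ^ 2)) := by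
  suffices h : ∃ (Ω : Type) (_ : Fintype Ω) (_ : Nonempty Ω) (R : (Fin k → ℂ) → Ω → ℂ),
      (∀ x y, ∑ w, (starRingEnd ℂ) (R x w) * R y w =
        Fintype.card Ω * ∑ l, (starRingEnd ℂ) (x l) * y l) ∧
      (∀ x, ∑ w, ‖R x w‖ ^ 4 ≤ Fintype.card Ω * (3 * (∑ l, ‖x l‖ ^ 2) ^ 2)) by
    obtain ⟨Ω, _, _, R, h1, h2⟩ := h
    let e := (Fintype.equivFin Ω).symm
    refine ⟨Fintype.card Ω, Fintype.card_pos, fun x w => R x (e w), fun x y => ?_, fun x => ?_⟩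
    · rw [← h1, ← e.sum_comp]
    · refine le_trans (le_of_eq ?_) (h2 x)
      rw [← e.sum_comp]
  induction k with
  | zero => exact ⟨Unit, inferInstance, inferInstance, fun _ _ => 0, by simp, by simp⟩
  | succ k ih =>
    obtain ⟨Ω, _, _, R, h1, h2⟩ := ih
    refine ⟨Ω × Bool, inferInstance, inferInstance,
      fun x w => R (Fin.tail x) w.1 + (if w.2 then x 0 else - x 0), fun x y => ?_, fun x => ?_⟩
    · have h := h1 (Fin.tail x) (Fin.tail y)
      simp only [Fintype.sum_prod_type, Fintype.sum_bool, Fin.sum_univ_succ, Fintype.card_prod,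
        Fintype.card_bool, if_true, Bool.false_eq_true, if_false, map_add, map_neg]
      have h' : ∀ w, ((starRingEnd ℂ) (R (Fin.tail x) w) + (starRingEnd ℂ) (x 0)) *
            (R (Fin.tail y) w + y 0) +
          ((starRingEnd ℂ) (R (Fin.tail x) w) + -(starRingEnd ℂ) (x 0)) *
            (R (Fin.tail y) w + -y 0) =
          2 * ((starRingEnd ℂ) (R (Fin.tail x) w) * R (Fin.tail y) w) +
            2 * ((starRingEnd ℂ) (x 0) * y 0) := fun w => by ring
      simp only [h', Finset.sum_add_distrib, ← Finset.mul_sum, h, Finset.sum_const,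
        Finset.card_univ, nsmul_eq_mul, Fin.tail]
      push_cast
      ring
    · have h := h2 (Fin.tail x)
      have hs : ∑ w, ‖R (Fin.tail x) w‖ ^ 2 = Fintype.card Ω * ∑ l, ‖Fin.tail x l‖ ^ 2 := by
        have h3 := h1 (Fin.tail x) (Fin.tail x)
        simp only [Complex.conj_mul'] at h3
        exact_mod_cast h3
      -- the parallelogram law and the Cauchy-Schwarz inequality in `ℂ = ℝ²`
      have key : ∀ s a : ℂ, ‖s + a‖ ^ 4 + ‖s + -a‖ ^ 4 ≤
          2 * ‖s‖ ^ 4 + 12 * ‖a‖ ^ 2 * ‖s‖ ^ 2 + 2 * ‖a‖ ^ 4 := by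
        intro s a
        have e : ∀ z : ℂ, ‖z‖ ^ 2 = z.re ^ 2 + z.im ^ 2 := fun z => by
          rw [Complex.sq_norm, Complex.normSq_apply]; ring
        have e4 : ∀ z : ℂ, ‖z‖ ^ 4 = (z.re ^ 2 + z.im ^ 2) ^ 2 := fun z => by
          rw [← e]; ring
        rw [e4, e4, e4, e4, e, e]
        simp only [Complex.add_re, Complex.add_im, Complex.neg_re, Complex.neg_im]
        nlinarith [sq_nonneg (s.re * a.im - s.im * a.re)]
      simp only [Fintype.sum_prod_type, Fintype.sum_bool, Fin.sum_univ_succ, Fintype.card_prod,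
        Fintype.card_bool, if_true, Bool.false_eq_true, if_false]
      refine (Finset.sum_le_sum fun w _ => key _ _).trans ?_
      simp only [Finset.sum_add_distrib, ← Finset.mul_sum, hs, Finset.sum_const,
        Finset.card_univ, nsmul_eq_mul]
      simp only [Fin.tail] at h ⊢
      have hc : (0 : ℝ) ≤ Fintype.card Ω := by positivity
      have : (0 : ℝ) ≤ Fintype.card Ω * ‖x 0‖ ^ 4 := by positivity
      push_cast
      nlinarith

/-- The bilinear form of `a` on the polydiscs is bounded by `1`. -/
def IsContractiveForm {I J : Type*} [Fintype I] [Fintype J] (a : I → J → ℂ) : Prop :=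
  ∀ (s : I → ℂ) (t : J → ℂ), (∀ i, ‖s i‖ ≤ 1) → (∀ j, ‖t j‖ ≤ 1) →
    ‖∑ i, ∑ j, a i j * s i * t j‖ ≤ 1

theorem IsGrothendieckBound.nonneg {K : ℝ} (hK : IsGrothendieckBound K) : 0 ≤ K :=
  (norm_nonneg _).trans (hK 0 0 0 (by simp) 0 0 0 (by simp) (by simp))

/-- A Grothendieck bound, for arbitrary finite index sets, with coordinates written out. -/
theorem IsGrothendieckBound.norm_sum_le {K : ℝ} (hK : IsGrothendieckBound K)
    {I J ι : Type*} [Fintype I] [Fintype J] [Fintype ι] {a : I → J → ℂ}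
    (ha : IsContractiveForm a) (x : I → ι → ℂ) (y : J → ι → ℂ) {r s : ℝ} (hr : 0 < r) (hs : 0 < s)
    (hx : ∀ i, ∑ w, ‖x i w‖ ^ 2 ≤ r ^ 2) (hy : ∀ j, ∑ w, ‖y j w‖ ^ 2 ≤ s ^ 2) :
    ‖∑ i, ∑ j, a i j * ∑ w, (starRingEnd ℂ) (x i w) * y j w‖ ≤ K * (r * s) := by
  let eI := (Fintype.equivFin I).symm
  let eJ := (Fintype.equivFin J).symm
  let ew := (Fintype.equivFin ι).symm
  have hn : ∀ (r : ℝ) (_ : 0 < r) (v : ι → ℂ), ∑ w, ‖v w‖ ^ 2 ≤ r ^ 2 →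
      ‖WithLp.toLp 2 (fun w => (r : ℂ)⁻¹ * v (ew w))‖ ≤ 1 := by
    intro r hr v hv
    rw [← sq_le_one_iff₀ (norm_nonneg _), EuclideanSpace.norm_sq_eq]
    simp only [norm_mul, mul_pow, ← Finset.mul_sum]
    rw [ew.sum_comp (fun w => ‖v w‖ ^ 2), norm_inv, Complex.norm_real, Real.norm_eq_abs,
      abs_of_pos hr]
    calc r⁻¹ ^ 2 * ∑ w, ‖v w‖ ^ 2 ≤ r⁻¹ ^ 2 * r ^ 2 := by gcongr
      _ = 1 := by field_simp
  have h := hK _ _ (fun i j => a (eI i) (eJ j)) (fun s t hs ht => by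
      have h := ha (fun i => s (eI.symm i)) (fun j => t (eJ.symm j))
        (fun i => hs _) (fun j => ht _)
      rw [← eI.sum_comp] at h
      simp only [← eJ.sum_comp (fun j => _ * t (eJ.symm j)), Equiv.symm_apply_apply] at h
      exact h) _
    (fun i => WithLp.toLp 2 (fun w => (r : ℂ)⁻¹ * x (eI i) (ew w)))
    (fun j => WithLp.toLp 2 (fun w => (s : ℂ)⁻¹ * y (eJ j) (ew w)))
    (fun i => hn r hr _ (hx _)) (fun j => hn s hs _ (hy _))
  have h2 : ∑ i, ∑ j, a i j * ∑ w, (starRingEnd ℂ) (x i w) * y j w = (r * s : ℂ) *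
      ∑ i, ∑ j, a (eI i) (eJ j) * inner ℂ
        (WithLp.toLp 2 (fun w => (r : ℂ)⁻¹ * x (eI i) (ew w)))
        (WithLp.toLp 2 (fun w => (s : ℂ)⁻¹ * y (eJ j) (ew w))) := by
    rw [← eI.sum_comp, Finset.mul_sum]
    refine Finset.sum_congr rfl fun i _ => ?_
    rw [← eJ.sum_comp, Finset.mul_sum]
    refine Finset.sum_congr rfl fun j _ => ?_
    rw [← ew.sum_comp]
    simp only [PiLp.inner_apply, RCLike.inner_apply, map_mul, map_inv₀, Complex.conj_ofReal]
    rw [Finset.mul_sum, Finset.mul_sum, Finset.mul_sum]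
    refine Finset.sum_congr rfl fun w _ => ?_
    have hr' : (r : ℂ) ≠ 0 := by exact_mod_cast hr.ne'
    have hs' : (s : ℂ) ≠ 0 := by exact_mod_cast hs.ne'
    field_simp
  rw [h2, norm_mul, mul_comm]
  have h3 : ‖(r * s : ℂ)‖ = r * s := by
    rw [norm_mul, Complex.norm_real, Complex.norm_real, Real.norm_eq_abs, Real.norm_eq_abs,
      abs_of_pos hr, abs_of_pos hs]
  rw [h3]
  exact mul_le_mul_of_nonneg_right h (by positivity)

/-- Truncation of `|v|²` at level `48`: the remainder has small mean square if the fourth moment is at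
most `3`. -/
theorem sum_truncated_sq_le {N : ℕ} (v : Fin N → ℂ) (hv : ∑ w, ‖v w‖ ^ 4 ≤ N * 3) :
    ∑ w, ‖if ‖v w‖ ^ 2 ≤ 48 then 0 else v w‖ ^ 2 ≤ N * (1 / 4) ^ 2 := by
  have h : ∀ w, ‖if ‖v w‖ ^ 2 ≤ 48 then 0 else v w‖ ^ 2 ≤ ‖v w‖ ^ 4 / 48 := by
    intro w
    split_ifs with h
    · rw [norm_zero, zero_pow two_ne_zero]; positivity
    · nlinarith
  refine (Finset.sum_le_sum fun w _ => h w).trans ?_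
  rw [← Finset.sum_div]
  linarith

/-- **Grothendieck's inequality** holds with some finite constant. Let `Γ` be the best constant for
the given matrix. The vectors are realized as Rademacher sums and truncated: the bounded parts are
estimated pointwise, by `48`, and each of the two terms with a remainder, of norm at most `1 / 4`,
by `Γ / 4`. So `Γ ≤ 48 + Γ / 2`. -/
theorem isGrothendieckBound_explicit : IsGrothendieckBound 96 := by
  intro m n a ha k₀ x₀ y₀ hx₀ hy₀
  let S : Set ℝ := {r | ∃ (k : ℕ) (x : Fin m → EuclideanSpace ℂ (Fin k))
    (y : Fin n → EuclideanSpace ℂ (Fin k)), (∀ i, ‖x i‖ ≤ 1) ∧ (∀ j, ‖y j‖ ≤ 1) ∧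
      r = ‖∑ i, ∑ j, a i j * inner ℂ (x i) (y j)‖}
  have hbdd : BddAbove S := by
    refine ⟨∑ i, ∑ j, ‖a i j‖, ?_⟩
    rintro r ⟨k, x, y, hx, hy, rfl⟩
    refine norm_sum_le_of_le _ fun i _ => norm_sum_le_of_le _ fun j _ => ?_
    rw [norm_mul]
    refine mul_le_of_le_one_right (norm_nonneg _) ((norm_inner_le_norm _ _).trans ?_)
    exact mul_le_one₀ (hx i) (norm_nonneg _) (hy j)
  have hmem : ‖∑ i, ∑ j, a i j * inner ℂ (x₀ i) (y₀ j)‖ ∈ S := ⟨k₀, x₀, y₀, hx₀, hy₀, rfl⟩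
  -- rescaled form of the definition of `sSup S`, for vectors of an `L²` space
  have hL2 : ∀ {N : ℕ} (_ : 0 < N) (X : Fin m → Fin N → ℂ) (Y : Fin n → Fin N → ℂ) (r s : ℝ),
      0 < r → 0 < s → (∀ i, ∑ w, ‖X i w‖ ^ 2 ≤ N * r ^ 2) →
      (∀ j, ∑ w, ‖Y j w‖ ^ 2 ≤ N * s ^ 2) →
      ‖∑ i, ∑ j, a i j * ∑ w, (starRingEnd ℂ) (X i w) * Y j w‖ ≤ N * (sSup S * (r * s)) := by
    intro N hN X Y r s hr hs hX hY
    have hN' : (0 : ℝ) < N := by exact_mod_cast hN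
    have hn : ∀ (r : ℝ) (_ : 0 < r) (v : Fin N → ℂ), ∑ w, ‖v w‖ ^ 2 ≤ N * r ^ 2 →
        ‖WithLp.toLp 2 (fun w => ((Real.sqrt N * r : ℝ) : ℂ)⁻¹ * v w)‖ ≤ 1 := by
      intro r hr v hv
      rw [← sq_le_one_iff₀ (norm_nonneg _), EuclideanSpace.norm_sq_eq]
      simp only [norm_mul, mul_pow, ← Finset.mul_sum]
      rw [norm_inv, Complex.norm_real, Real.norm_eq_abs, abs_of_pos (by positivity), inv_pow,
        mul_pow, Real.sq_sqrt hN'.le]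
      rw [inv_mul_le_iff₀ (by positivity), mul_one]
      exact hv
    have h := le_csSup hbdd ⟨N, fun i => WithLp.toLp 2
      (fun w => ((Real.sqrt N * r : ℝ) : ℂ)⁻¹ * X i w), fun j => WithLp.toLp 2
      (fun w => ((Real.sqrt N * s : ℝ) : ℂ)⁻¹ * Y j w), fun i => hn r hr _ (hX i),
      fun j => hn s hs _ (hY j), rfl⟩
    have h2 : ∑ i, ∑ j, a i j * ∑ w, (starRingEnd ℂ) (X i w) * Y j w =
        ((N * (r * s) : ℝ) : ℂ) * ∑ i, ∑ j, a i j * inner ℂ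
          (WithLp.toLp 2 (fun w => ((Real.sqrt N * r : ℝ) : ℂ)⁻¹ * X i w))
          (WithLp.toLp 2 (fun w => ((Real.sqrt N * s : ℝ) : ℂ)⁻¹ * Y j w)) := by
      rw [Finset.mul_sum]
      refine Finset.sum_congr rfl fun i _ => ?_
      rw [Finset.mul_sum]
      refine Finset.sum_congr rfl fun j _ => ?_
      simp only [PiLp.inner_apply, RCLike.inner_apply, map_mul, map_inv₀, Complex.conj_ofReal]
      rw [Finset.mul_sum, Finset.mul_sum, Finset.mul_sum]
      refine Finset.sum_congr rfl fun w _ => ?_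
      have hr' : (r : ℂ) ≠ 0 := by exact_mod_cast hr.ne'
      have hs' : (s : ℂ) ≠ 0 := by exact_mod_cast hs.ne'
      have hq : ((Real.sqrt N : ℝ) : ℂ) ≠ 0 := by
        exact_mod_cast (Real.sqrt_pos.2 hN').ne'
      have hq2 : ((N : ℝ) : ℂ) = (Real.sqrt N : ℝ) * (Real.sqrt N : ℝ) := by
        rw [← Complex.ofReal_mul, Real.mul_self_sqrt hN'.le]
      push_cast at hq2 ⊢
      rw [hq2]
      field_simp
    rw [h2, norm_mul, Complex.norm_real, Real.norm_eq_abs, abs_of_pos (by positivity)]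
    calc _ ≤ N * (r * s) * sSup S := by gcongr
      _ = _ := by ring
  have hsup : sSup S ≤ 48 + sSup S / 2 := by
    refine csSup_le ⟨_, hmem⟩ ?_
    rintro _ ⟨k, x, y, hx, hy, rfl⟩
    obtain ⟨N, hN, R, h1, h2⟩ := exists_rademacher_embedding k
    have hN' : (0 : ℝ) < N := by exact_mod_cast hN
    have hsq : ∀ v : EuclideanSpace ℂ (Fin k), ‖v‖ ≤ 1 → ∑ l, ‖v l‖ ^ 2 ≤ 1 := by
      intro v hv
      rw [← EuclideanSpace.norm_sq_eq]
      exact pow_le_one₀ (norm_nonneg _) hv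
    have h4 : ∀ v : EuclideanSpace ℂ (Fin k), ‖v‖ ≤ 1 → ∑ w, ‖R v w‖ ^ 4 ≤ N * 3 := by
      intro v hv
      refine (h2 v).trans ?_
      have := pow_le_one₀ (n := 2) (Finset.sum_nonneg fun l _ => by positivity) (hsq v hv)
      gcongr
      linarith
    have h22 : ∀ v : EuclideanSpace ℂ (Fin k), ‖v‖ ≤ 1 → ∑ w, ‖R v w‖ ^ 2 ≤ N * 1 ^ 2 := by
      intro v hv
      have h3 := h1 v v
      simp only [Complex.conj_mul'] at h3
      have h3' : ∑ w, ‖R v w‖ ^ 2 = N * ∑ l, ‖v l‖ ^ 2 := by exact_mod_cast h3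
      rw [h3']
      have := hsq v hv
      gcongr
      linarith
    -- splitting into a bounded part and a remainder
    let lo : EuclideanSpace ℂ (Fin k) → Fin N → ℂ := fun v w =>
      if ‖R v w‖ ^ 2 ≤ 48 then R v w else 0
    let hi : EuclideanSpace ℂ (Fin k) → Fin N → ℂ := fun v w =>
      if ‖R v w‖ ^ 2 ≤ 48 then 0 else R v w
    have hsplit : ∀ (v : EuclideanSpace ℂ (Fin k)) w, R v w = lo v w + hi v w := by
      intro v w
      simp only [lo, hi]
      split_ifs <;> simp
    have hlo : ∀ v w, ‖lo v w‖ ≤ Real.sqrt 48 := by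
      intro v w
      refine Real.le_sqrt_of_sq_le ?_
      simp only [lo]
      split_ifs with h
      · exact h
      · simp
    have hlo2 : ∀ v : EuclideanSpace ℂ (Fin k), ‖v‖ ≤ 1 → ∑ w, ‖lo v w‖ ^ 2 ≤ N * 1 ^ 2 := by
      intro v hv
      refine (Finset.sum_le_sum fun w _ => ?_).trans (h22 v hv)
      simp only [lo]
      split_ifs with h
      · exact le_rfl
      · simp
    have hhi : ∀ v : EuclideanSpace ℂ (Fin k), ‖v‖ ≤ 1 →
        ∑ w, ‖hi v w‖ ^ 2 ≤ N * (1 / 4) ^ 2 := fun v hv => sum_truncated_sq_le _ (h4 v hv)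
    have hA : ‖∑ i, ∑ j, a i j * ∑ w, (starRingEnd ℂ) (lo (x i) w) * lo (y j) w‖ ≤ N * 48 := by
      have hswap : ∑ i, ∑ j, a i j * ∑ w, (starRingEnd ℂ) (lo (x i) w) * lo (y j) w =
          ∑ w, ∑ i, ∑ j, a i j * (starRingEnd ℂ) (lo (x i) w) * lo (y j) w := by
        simp only [Finset.mul_sum, ← mul_assoc]
        rw [Finset.sum_comm (s := Finset.univ (α := Fin N))]
        exact Finset.sum_congr rfl fun i _ => Finset.sum_comm
      rw [hswap]
      refine (norm_sum_le_of_le (n := fun _ => 48) _ fun w _ => ?_).trans (by simp)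
      have hq : (0 : ℝ) < Real.sqrt 48 := by positivity
      have hq' : ((Real.sqrt 48 : ℝ) : ℂ) ≠ 0 := by exact_mod_cast hq.ne'
      have hb : ∀ z : ℂ, ‖z‖ ≤ Real.sqrt 48 → ‖((Real.sqrt 48 : ℝ) : ℂ)⁻¹ * z‖ ≤ 1 := by
        intro z hz
        rw [norm_mul, norm_inv, Complex.norm_real, Real.norm_eq_abs, abs_of_pos hq,
          inv_mul_le_iff₀ hq, mul_one]
        exact hz
      have h := ha (fun i => ((Real.sqrt 48 : ℝ) : ℂ)⁻¹ * (starRingEnd ℂ) (lo (x i) w))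
        (fun j => ((Real.sqrt 48 : ℝ) : ℂ)⁻¹ * lo (y j) w)
        (fun i => hb _ (by rw [RCLike.norm_conj]; exact hlo _ _)) (fun j => hb _ (hlo _ _))
      have he : ∑ i, ∑ j, a i j * (starRingEnd ℂ) (lo (x i) w) * lo (y j) w = (48 : ℂ) *
          ∑ i, ∑ j, a i j * (((Real.sqrt 48 : ℝ) : ℂ)⁻¹ * (starRingEnd ℂ) (lo (x i) w)) *
            (((Real.sqrt 48 : ℝ) : ℂ)⁻¹ * lo (y j) w) := by
        have h48 : (48 : ℂ) = (Real.sqrt 48 : ℝ) * (Real.sqrt 48 : ℝ) := by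
          rw [← Complex.ofReal_mul, Real.mul_self_sqrt (by norm_num)]; norm_num
        simp only [Finset.mul_sum]
        refine Finset.sum_congr rfl fun i _ => Finset.sum_congr rfl fun j _ => ?_
        rw [h48]
        field_simp
      rw [he, norm_mul]
      have : ‖(48 : ℂ)‖ = 48 := by norm_num
      rw [this]
      linarith
    have hB := hL2 hN (fun i => lo (x i)) (fun j => hi (y j)) 1 (1 / 4) (by norm_num)
      (by norm_num) (fun i => hlo2 _ (hx i)) (fun j => hhi _ (hy j))
    have hC := hL2 hN (fun i => hi (x i)) (fun j => R (y j)) (1 / 4) 1 (by norm_num)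
      (by norm_num) (fun i => hhi _ (hx i)) (fun j => h22 _ (hy j))
    have hsum : (N : ℂ) * ∑ i, ∑ j, a i j * inner ℂ (x i) (y j) =
        (∑ i, ∑ j, a i j * ∑ w, (starRingEnd ℂ) (lo (x i) w) * lo (y j) w) +
        (∑ i, ∑ j, a i j * ∑ w, (starRingEnd ℂ) (lo (x i) w) * hi (y j) w) +
        (∑ i, ∑ j, a i j * ∑ w, (starRingEnd ℂ) (hi (x i) w) * R (y j) w) := by
      rw [Finset.mul_sum, ← Finset.sum_add_distrib, ← Finset.sum_add_distrib]
      refine Finset.sum_congr rfl fun i _ => ?_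
      rw [Finset.mul_sum, ← Finset.sum_add_distrib, ← Finset.sum_add_distrib]
      refine Finset.sum_congr rfl fun j _ => ?_
      have hin : inner ℂ (x i) (y j) = ∑ l, (starRingEnd ℂ) (x i l) * y j l := by
        simp only [PiLp.inner_apply, RCLike.inner_apply]
        exact Finset.sum_congr rfl fun l _ => mul_comm _ _
      rw [hin, mul_left_comm, ← h1, ← mul_add, ← mul_add, ← Finset.sum_add_distrib,
        ← Finset.sum_add_distrib]
      congr 1
      refine Finset.sum_congr rfl fun w _ => ?_
      rw [hsplit (x i) w, map_add]
      rw [hsplit (y j) w]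
      ring
    have hfin := congrArg norm hsum
    rw [norm_mul, Complex.norm_natCast] at hfin
    have h5 := hfin.le.trans (norm_add₃_le.trans (add_le_add (add_le_add hA hB) hC))
    have h6 : (N : ℝ) * ‖∑ i, ∑ j, a i j * inner ℂ (x i) (y j)‖ ≤ N * (48 + sSup S / 2) := by
      refine h5.trans (le_of_eq ?_)
      ring
    exact le_of_mul_le_mul_left h6 hN'
  have := le_csSup hbdd hmem
  linarith

/-- The infimum in the definition of `K_G` is attained. -/
theorem isGrothendieckBound_grothendieckConstant : IsGrothendieckBound grothendieckConstant := by
  intro m n a ha k x y hx hy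
  exact le_csInf ⟨96, isGrothendieckBound_explicit⟩ fun K hK => hK m n a ha k x y hx hy

theorem grothendieckConstant_nonneg : 0 ≤ grothendieckConstant :=
  isGrothendieckBound_grothendieckConstant.nonneg

/-! ### Homogeneous polynomials on the polydisc -/

namespace MvPolynomial

theorem hasDerivAt_eval {σ : Type*} [Fintype σ] (p : MvPolynomial σ ℂ) {h : ℂ → σ → ℂ} {h' : σ → ℂ}
    {l : ℂ} (hh : ∀ i, HasDerivAt (fun l => h l i) (h' i) l) :
    HasDerivAt (fun l => eval (h l) p) (∑ i, h' i * eval (h l) (pderiv i p)) l := by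
  classical
  induction p using MvPolynomial.induction_on with
  | C a => simpa using hasDerivAt_const l a
  | add p q hp hq =>
    simp only [map_add, mul_add, Finset.sum_add_distrib]
    exact hp.add hq
  | mul_X p i hp =>
    simp only [map_mul, eval_X]
    refine (hp.mul (hh i)).congr_deriv ?_
    have : ∀ j, h' j * eval (h l) (pderiv j (p * X i)) =
        h' j * eval (h l) (pderiv j p) * h l i + (if j = i then eval (h l) p * h' i else 0) := by
      intro j
      rw [pderiv_mul, pderiv_X]
      by_cases hij : j = i
      · subst hij; simp; ring
      · simp [hij, Ne.symm hij]; ring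
    simp only [this, Finset.sum_add_distrib, ← Finset.sum_mul]
    simp

theorem IsHomogeneous.aeval_smul {σ A : Type*} [CommRing A] [Algebra ℂ A] {p : MvPolynomial σ ℂ}
    {k : ℕ} (hp : p.IsHomogeneous k) (c : ℂ) (a : σ → A) :
    MvPolynomial.aeval (fun i => c • a i) p = c ^ k • MvPolynomial.aeval a p := by
  rw [aeval_def, aeval_def, eval₂_eq, eval₂_eq, Finset.smul_sum]
  refine Finset.sum_congr rfl fun d hd => ?_
  simp only [smul_pow]
  rw [Finset.prod_smul, Finset.prod_pow_eq_pow_sum, hp.degree_eq_sum_deg_support hd,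
    mul_smul_comm]

theorem IsHomogeneous.eval_mul_left {σ : Type*} {p : MvPolynomial σ ℂ}
    {k : ℕ} (hp : p.IsHomogeneous k) (c : ℂ) (z : σ → ℂ) :
    eval (fun i => c * z i) p = c ^ k * eval z p := by
  have h := IsHomogeneous.aeval_smul hp c z
  simpa [MvPolynomial.aeval_eq_eval] using h

/-- A Schwarz-Pick estimate on the polydisc: composing `p` with the coordinatewise Möbius
transformations that move `0` to `w j` gives a function bounded on the unit circle, whose derivative
at `0` is estimated by Cauchy's inequality. -/
theorem norm_sum_mul_eval_pderiv_le {σ : Type*} [Fintype σ] {p : MvPolynomial σ ℂ} {N r : ℝ}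
    (hp : ∀ z : σ → ℂ, (∀ i, ‖z i‖ = 1) → ‖eval z p‖ ≤ N) (hr1 : r < 1)
    {w y : σ → ℂ} (hw : ∀ i, ‖w i‖ = r) (hr0 : 0 ≤ r) (hy : ∀ i, ‖y i‖ = 1) :
    (1 - r ^ 2) * ‖∑ i, y i * eval w (pderiv i p)‖ ≤ N := by
  let h : ℂ → σ → ℂ := fun l i => (w i + l * y i) / (1 + (starRingEnd ℂ) (w i) * (l * y i))
  have hden : ∀ l : ℂ, ‖l‖ ≤ 1 → ∀ i, 1 + (starRingEnd ℂ) (w i) * (l * y i) ≠ 0 := by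
    intro l hl i h0
    have h1 : ‖(starRingEnd ℂ) (w i) * (l * y i)‖ = 1 := by
      rw [← norm_neg, ← eq_neg_of_add_eq_zero_left h0, norm_one]
    rw [norm_mul, norm_mul, RCLike.norm_conj, hw, hy, mul_one] at h1
    nlinarith [norm_nonneg l]
  have hderiv : ∀ l : ℂ, ‖l‖ ≤ 1 → ∀ i, HasDerivAt (fun l => h l i)
      ((y i * (1 + (starRingEnd ℂ) (w i) * (l * y i)) -
        (w i + l * y i) * ((starRingEnd ℂ) (w i) * y i)) /
        (1 + (starRingEnd ℂ) (w i) * (l * y i)) ^ 2) l := by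
    intro l hl i
    have h1 : HasDerivAt (fun l => w i + l * y i) (y i) l := by
      simpa using ((hasDerivAt_id l).mul_const (y i)).const_add (w i)
    have h2 : HasDerivAt (fun l => 1 + (starRingEnd ℂ) (w i) * (l * y i))
        ((starRingEnd ℂ) (w i) * y i) l := by
      simpa using
        (((hasDerivAt_id l).mul_const (y i)).const_mul ((starRingEnd ℂ) (w i))).const_add 1
    exact h1.div h2 (hden l hl i)
  have hcirc : ∀ l : ℂ, ‖l‖ = 1 → ∀ i, ‖h l i‖ = 1 := by
    intro l hl i
    have hu : ‖l * y i‖ = 1 := by rw [norm_mul, hl, hy, mul_one]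
    have hn : ‖w i + l * y i‖ = ‖1 + (starRingEnd ℂ) (w i) * (l * y i)‖ := by
      have hc : (l * y i) * (starRingEnd ℂ) (l * y i) = 1 := by
        rw [Complex.mul_conj', hu]; simp
      have : w i + l * y i = (l * y i) * (starRingEnd ℂ) (1 + (starRingEnd ℂ) (w i) * (l * y i)) := by
        rw [map_add, map_mul, Complex.conj_conj, map_one]
        linear_combination (-w i) * hc
      rw [this, norm_mul, hu, one_mul, RCLike.norm_conj]
    simp only [h]
    rw [norm_div, hn, div_self]
    exact norm_ne_zero_iff.2 (hden l hl.le i)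
  have hd : DiffContOnCl ℂ (fun l => eval (h l) p) (Metric.ball 0 1) := by
    refine DifferentiableOn.diffContOnCl fun l hl => ?_
    rw [closure_ball _ one_ne_zero, mem_closedBall_zero_iff] at hl
    exact (hasDerivAt_eval p (hderiv l hl)).differentiableAt.differentiableWithinAt
  have hmain := Complex.norm_deriv_le_of_forall_mem_sphere_norm_le one_pos hd (C := N)
    (fun l hl => hp _ (hcirc l (by simpa using hl)))
  have h0 : h 0 = w := by ext i; simp [h]
  rw [(hasDerivAt_eval p (hderiv 0 (by simp))).deriv, div_one, h0] at hmain
  refine le_trans (le_of_eq ?_) hmain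
  have hr2 : 0 ≤ 1 - r ^ 2 := by nlinarith
  have hc : ((1 - r ^ 2 : ℝ) : ℂ) * ∑ i, y i * eval w (pderiv i p) =
      ∑ i, (y i * (1 + (starRingEnd ℂ) (w i) * (0 * y i)) -
        (w i + 0 * y i) * ((starRingEnd ℂ) (w i) * y i)) /
        (1 + (starRingEnd ℂ) (w i) * (0 * y i)) ^ 2 * eval w (pderiv i p) := by
    rw [Finset.mul_sum]
    refine Finset.sum_congr rfl fun i _ => ?_
    have hwi : w i * (starRingEnd ℂ) (w i) = (r : ℂ) ^ 2 := by
      rw [Complex.mul_conj', hw]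
    simp only [zero_mul, mul_zero, add_zero, one_pow, div_one, mul_one]
    push_cast
    linear_combination (y i * eval w (pderiv i p)) * hwi
  rw [← hc, norm_mul, Complex.norm_real, Real.norm_eq_abs, abs_of_nonneg hr2]

end MvPolynomial

/-- The trapezoidal bound for the integral of `1 / s` over `[t, t + 1]`. -/
theorem Real.log_add_one_div_le {t : ℝ} (ht : 0 < t) :
    Real.log ((t + 1) / t) ≤ (2 * t + 1) / (2 * t * (t + 1)) := by
  have h1 : 1 ≤ (t + 1) / t := by rw [le_div_iff₀ ht]; linarith
  have h := Real.self_le_sinh_iff.2 (Real.log_nonneg h1)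
  rw [Real.sinh_log (by positivity)] at h
  refine h.trans (le_of_eq ?_)
  field_simp
  ring

/-- The radius `√(m / (m + 2))` is the best one in the polarization estimate for homogeneous
polynomials of degree `m + 1` on the polydisc; it yields the constant `e / 2` per degree. -/
theorem add_two_le_exp_mul_sqrt_pow (m : ℕ) :
    (m : ℝ) + 2 ≤ (m + 1) * Real.exp 1 * Real.sqrt (m / (m + 2)) ^ m := by
  rcases Nat.eq_zero_or_pos m with rfl | hm
  · have := Real.add_one_le_exp (1 : ℝ)
    norm_num at this ⊢
    exact this
  have hm' : (0 : ℝ) < m := by exact_mod_cast hm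
  rw [← Real.log_le_log_iff (by positivity) (by positivity), Real.log_mul (by positivity)
    (by positivity), Real.log_mul (by positivity) (by positivity), Real.log_exp, Real.log_pow,
    Real.log_sqrt (by positivity), Real.log_div (by positivity) (by positivity)]
  have h1 := Real.log_add_one_div_le hm'
  have h2 := Real.log_add_one_div_le (show (0 : ℝ) < m + 1 by positivity)
  rw [Real.log_div (by positivity) (by positivity)] at h1 h2
  rw [show (m : ℝ) + 1 + 1 = m + 2 by ring] at h2
  have h3 := mul_le_mul_of_nonneg_left h1 (show (0 : ℝ) ≤ m / 2 by positivity)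
  have h4 := mul_le_mul_of_nonneg_left h2 (show (0 : ℝ) ≤ (m + 2) / 2 by positivity)
  have h5 : (m : ℝ) / 2 * ((2 * m + 1) / (2 * m * (m + 1))) +
      (m + 2) / 2 * ((2 * (m + 1) + 1) / (2 * (m + 1) * (m + 2))) = 1 := by
    field_simp
    ring
  linarith

namespace MvPolynomial

/-- One step of polarization on the polydisc: differentiating a homogeneous polynomial of degree
`m + 1` in a direction of the torus costs at most a factor `(m + 1) e / 2`. -/
theorem IsHomogeneous.norm_sum_mul_eval_pderiv_le {σ : Type*} [Fintype σ] {p : MvPolynomial σ ℂ}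
    {m : ℕ} (hom : p.IsHomogeneous (m + 1)) {N : ℝ}
    (hp : ∀ z : σ → ℂ, (∀ i, ‖z i‖ = 1) → ‖eval z p‖ ≤ N)
    {z y : σ → ℂ} (hz : ∀ i, ‖z i‖ = 1) (hy : ∀ i, ‖y i‖ = 1) :
    ‖∑ i, y i * eval z (pderiv i p)‖ ≤ (m + 1) * (Real.exp 1 / 2) * N := by
  set r := Real.sqrt (m / (m + 2)) with hr
  have hr0 : 0 ≤ r := Real.sqrt_nonneg _
  have hr2 : r ^ 2 = m / (m + 2) := Real.sq_sqrt (by positivity)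
  have hr1 : r < 1 := by
    rw [hr, Real.sqrt_lt' one_pos, div_lt_iff₀ (by positivity)]; linarith
  have h := MvPolynomial.norm_sum_mul_eval_pderiv_le hp hr1 (w := fun i => (r : ℂ) * z i) (y := y)
    (fun i => by rw [norm_mul, hz, Complex.norm_real, Real.norm_eq_abs, abs_of_nonneg hr0, mul_one])
    hr0 hy
  have hs : ∀ i, eval (fun i => (r : ℂ) * z i) (pderiv i p) = (r : ℂ) ^ m * eval z (pderiv i p) :=
    fun i => (show (pderiv i p).IsHomogeneous m from hom.pderiv).eval_mul_left r z
  simp only [hs, mul_left_comm _ ((r : ℂ) ^ m)] at h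
  rw [← Finset.mul_sum, norm_mul, norm_pow, Complex.norm_real, Real.norm_eq_abs,
    abs_of_nonneg hr0, hr2] at h
  have hN : 0 ≤ N := (norm_nonneg _).trans (hp z hz)
  have hpos : 0 < r ^ m := by
    rcases Nat.eq_zero_or_pos m with rfl | hm
    · simp
    · have : 0 < r := Real.sqrt_pos.2 (by positivity)
      positivity
  have key := add_two_le_exp_mul_sqrt_pow m
  rw [← hr] at key
  have e1 : (1 - (m : ℝ) / (m + 2)) = 2 / (m + 2) := by field_simp; ring
  rw [e1] at h
  have h6 : r ^ m * ‖∑ i, y i * eval z (pderiv i p)‖ ≤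
      r ^ m * ((m + 1) * (Real.exp 1 / 2) * N) := by
    have h7 : r ^ m * ‖∑ i, y i * eval z (pderiv i p)‖ ≤ N * (m + 2) / 2 := by
      rw [le_div_iff₀ two_pos]
      rw [div_mul_eq_mul_div, div_le_iff₀ (by positivity)] at h
      linarith
    refine h7.trans ?_
    nlinarith [mul_le_mul_of_nonneg_left key hN]
  exact le_of_mul_le_mul_left h6 hpos

/-- The homogeneous components of a polynomial are averages of the polynomial over rotations, hence
no larger on the torus. -/
theorem norm_eval_homogeneousComponent_le {σ : Type*} {p : MvPolynomial σ ℂ} {N : ℝ}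
    (hp : ∀ z : σ → ℂ, (∀ i, ‖z i‖ = 1) → ‖eval z p‖ ≤ N) (k : ℕ) {z : σ → ℂ}
    (hz : ∀ i, ‖z i‖ = 1) : ‖eval z (homogeneousComponent k p)‖ ≤ N := by
  rcases lt_or_ge p.totalDegree k with hk | hk
  · rw [homogeneousComponent_eq_zero _ _ hk, map_zero, norm_zero]
    exact (norm_nonneg _).trans (hp z hz)
  set M := p.totalDegree + 1 with hM
  have hM0 : M ≠ 0 := by omega
  have hζ := Complex.isPrimitiveRoot_exp M hM0
  set ζ := Complex.exp (2 * Real.pi * Complex.I / M)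
  have hζ1 : ‖ζ‖ = 1 := hζ.norm'_eq_one hM0
  have hev : ∀ l : ℕ, eval (fun i => ζ ^ l * z i) p =
      ∑ i ∈ Finset.range M, (ζ ^ l) ^ i * eval z (homogeneousComponent i p) := by
    intro l
    conv_lhs => rw [← sum_homogeneousComponent p, map_sum]
    exact Finset.sum_congr rfl fun i _ =>
      (homogeneousComponent_isHomogeneous i p).eval_mul_left _ _
  have horth : ∀ i ∈ Finset.range M, ∑ l ∈ Finset.range M, (ζ ^ l) ^ (M - k) * (ζ ^ l) ^ i =
      if i = k then (M : ℂ) else 0 := by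
    intro i hi
    rw [Finset.mem_range] at hi
    have h1 : ∀ l, (ζ ^ l) ^ (M - k) * (ζ ^ l) ^ i = (ζ ^ (M - k + i)) ^ l := fun l => by
      rw [← pow_add, ← pow_mul, ← pow_mul, mul_comm]
    simp only [h1]
    split_ifs with hik
    · have : M - k + i = M := by omega
      rw [this, hζ.pow_eq_one]
      simp
    · have hne : ζ ^ (M - k + i) ≠ 1 := by
        intro h0
        have := hζ.dvd_of_pow_eq_one _ h0
        obtain ⟨c, hc⟩ := this
        rcases c with _ | _ | c
        · omega
        · omega
        · have : M * (c + 1 + 1) = M * c + M + M := by ring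
          have : 0 ≤ M * c := by positivity
          omega
      have := mul_neg_geom_sum (ζ ^ (M - k + i)) M
      rw [← pow_mul, mul_comm _ M, pow_mul, hζ.pow_eq_one, one_pow, sub_self] at this
      exact (mul_eq_zero.1 this).resolve_left (sub_ne_zero.2 hne.symm)
  have hsum : (M : ℂ) * eval z (homogeneousComponent k p) =
      ∑ l ∈ Finset.range M, (ζ ^ l) ^ (M - k) * eval (fun i => ζ ^ l * z i) p := by
    simp only [hev, Finset.mul_sum, ← mul_assoc]
    rw [Finset.sum_comm]
    simp only [← Finset.sum_mul]
    rw [Finset.sum_congr rfl fun i hi => by rw [horth i hi]]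
    rw [Finset.sum_eq_single k]
    · simp
    · intro i _ hik; simp [hik]
    · intro hk'; exact absurd (Finset.mem_range.2 (by omega)) hk'
  have hn := congrArg norm hsum
  rw [norm_mul, Complex.norm_natCast] at hn
  have hle : (M : ℝ) * ‖eval z (homogeneousComponent k p)‖ ≤ M * N := by
    rw [hn]
    refine (norm_sum_le_of_le (n := fun _ => N) _ fun l _ => ?_).trans (by simp)
    rw [norm_mul, norm_pow, norm_pow, hζ1, one_pow, one_pow, one_mul]
    exact hp _ fun i => by rw [norm_mul, norm_pow, hζ1, one_pow, one_mul, hz]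
  exact le_of_mul_le_mul_left hle (by positivity)

end MvPolynomial

/-! ### From the injective tensor product to the von Neumann inequality -/

/-- The multiplication of `A` is bounded by `C` on `A ⊗ A` for the injective tensor norm. A tensor
`∑ j, b j ⊗ a j` with `‖a j‖ ≤ 1` is controlled here through the larger quantity
`sup {‖∑ j, t j • b j‖ : |t j| ≤ 1}`. -/
def IsInjectiveMulBound (A : Type*) [NormedRing A] [NormedAlgebra ℂ A] (C : ℝ) : Prop :=
  ∀ (n : ℕ) (b a : Fin n → A) (N : ℝ),
    (∀ t : Fin n → ℂ, (∀ j, ‖t j‖ ≤ 1) → ‖∑ j, t j • b j‖ ≤ N) → (∀ j, ‖a j‖ ≤ 1) →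
      ‖∑ j, b j * a j‖ ≤ C * N

/-- The polydisc is the convex hull of the torus. -/
theorem norm_sum_smul_le_of_torus {ι A : Type*} [Fintype ι] [SeminormedAddCommGroup A]
    [NormedSpace ℂ A] {b : ι → A} {N : ℝ}
    (h : ∀ t : ι → ℂ, (∀ j, ‖t j‖ = 1) → ‖∑ j, t j • b j‖ ≤ N)
    {t : ι → ℂ} (ht : ∀ j, ‖t j‖ ≤ 1) : ‖∑ j, t j • b j‖ ≤ N := by
  let L : (ι → ℂ) →ₗ[ℝ] A :=
    { toFun := fun t => ∑ j, t j • b j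
      map_add' := fun s t => by simp [add_smul, Finset.sum_add_distrib]
      map_smul' := fun c t => by simp [Finset.smul_sum, mul_smul] }
  have hconv : ConvexOn ℝ Set.univ (fun t : ι → ℂ => ‖L t‖) :=
    (convexOn_univ_norm (E := A)).comp_linearMap L
  have hmem : t ∈ convexHull ℝ (Set.univ.pi fun _ : ι => Metric.sphere (0 : ℂ) 1) := by
    rw [convexHull_pi]
    intro i _
    rw [convexHull_sphere_eq_closedBall _ zero_le_one]
    simpa using ht i
  obtain ⟨s, hs, hle⟩ := hconv.exists_ge_of_mem_convexHull (Set.subset_univ _) hmem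
  exact hle.trans (h s fun j => by simpa using hs j (Set.mem_univ j))

section

variable {A : Type*} [NormedCommRing A] [NormedAlgebra ℂ A] {C : ℝ}

open MvPolynomial in
/-- A homogeneous polynomial is evaluated by Euler's identity, one factor at a time. -/
theorem IsInjectiveMulBound.norm_aeval_homogeneous_le (hA : IsInjectiveMulBound A C)
    (m n : ℕ) (p : MvPolynomial (Fin n) ℂ) (hom : p.IsHomogeneous (m + 1)) (N : ℝ)
    (hp : ∀ z : Fin n → ℂ, (∀ i, ‖z i‖ = 1) → ‖eval z p‖ ≤ N)
    (a : Fin n → A) (ha : ∀ i, ‖a i‖ ≤ 1) :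
    ‖aeval a p‖ ≤ (Real.exp 1 / 2 * C) ^ m * N := by
  induction m generalizing p N with
  | zero =>
    have heuler := hom.sum_X_mul_pderiv
    have hdeg : ∀ j, pderiv j p = MvPolynomial.C (coeff 0 (pderiv j p)) := fun j =>
      totalDegree_eq_zero_iff_eq_C.1 (Nat.le_zero.1
        ((show (pderiv j p).IsHomogeneous 0 from hom.pderiv).totalDegree_le))
    set c : Fin n → ℂ := fun j => coeff 0 (pderiv j p) with hc
    have hp' : p = ∑ j, X j * MvPolynomial.C (c j) := by
      rw [zero_add, one_smul] at heuler
      conv_lhs => rw [← heuler]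
      exact Finset.sum_congr rfl fun j _ => by rw [← hdeg j]
    -- the supremum of a linear form on the torus is the `ℓ¹`-norm of its coefficients
    have hN : ∑ j, ‖c j‖ ≤ N := by
      let t : Fin n → ℂ := fun j => if c j = 0 then 1 else (‖c j‖ : ℂ) / c j
      have ht : ∀ j, t j * c j = ‖c j‖ := by
        intro j
        simp only [t]
        split_ifs with h0
        · simp [h0]
        · field_simp
      have h := hp t fun j => by
        simp only [t]
        split_ifs with h0
        · simp
        · rw [norm_div, Complex.norm_real, norm_norm, div_self (norm_ne_zero_iff.2 h0)]
      rw [hp', map_sum] at h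
      simp only [map_mul, eval_X, eval_C, ht] at h
      rw [← Complex.ofReal_sum, Complex.norm_real] at h
      exact (le_abs_self _).trans h
    rw [hp', map_sum, pow_zero, one_mul]
    refine le_trans (norm_sum_le_of_le _ fun j _ => ?_) hN
    rw [map_mul, aeval_X, aeval_C, mul_comm, ← Algebra.smul_def, norm_smul]
    exact mul_le_of_le_one_right (norm_nonneg _) (ha j)
  | succ m ih =>
    have heuler := congrArg (aeval a) hom.sum_X_mul_pderiv
    rw [map_sum, map_nsmul] at heuler
    simp only [map_mul, aeval_X] at heuler
    set b : Fin n → A := fun j => aeval a (pderiv j p) with hb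
    have hm : (0 : ℝ) < (m + 1 : ℕ) + 1 := by positivity
    have key : ∀ t : Fin n → ℂ, (∀ j, ‖t j‖ ≤ 1) → ‖∑ j, t j • b j‖ ≤
        (Real.exp 1 / 2 * C) ^ m * (((m + 1 : ℕ) + 1) * (Real.exp 1 / 2) * N) := by
      intro t ht
      refine norm_sum_smul_le_of_torus (fun y hy => ?_) ht
      have h := ih (∑ j, MvPolynomial.C (y j) * pderiv j p)
        (IsHomogeneous.sum _ _ _ fun j _ =>
          (show (pderiv j p).IsHomogeneous (m + 1) from hom.pderiv).C_mul _)
        (((m + 1 : ℕ) + 1) * (Real.exp 1 / 2) * N) fun z hz => by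
          rw [map_sum]
          simp only [map_mul, eval_C]
          exact hom.norm_sum_mul_eval_pderiv_le hp hz hy
      rw [map_sum] at h
      simpa only [map_mul, aeval_C, ← Algebra.smul_def] using h
    have h1 := hA n b a _ key ha
    have h2 : ∑ j, b j * a j = ((m + 1 + 1 : ℕ) : ℂ) • aeval a p := by
      rw [Nat.cast_smul_eq_nsmul, ← heuler]
      exact Finset.sum_congr rfl fun j _ => mul_comm _ _
    rw [h2, norm_smul, Complex.norm_natCast] at h1
    have h3 : ((m + 1 + 1 : ℕ) : ℝ) * ‖aeval a p‖ ≤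
        ((m + 1 + 1 : ℕ) : ℝ) * ((Real.exp 1 / 2 * C) ^ (m + 1) * N) := by
      refine h1.trans (le_of_eq ?_)
      push_cast
      ring
    exact le_of_mul_le_mul_left h3 (by positivity)

theorem bddAbove_polydisc {n : ℕ} (p : MvPolynomial (Fin n) ℂ) :
    BddAbove {r : ℝ | ∃ z : Fin n → ℂ, (∀ i, ‖z i‖ ≤ 1) ∧ r = ‖MvPolynomial.eval z p‖} := by
  have hK : IsCompact (Set.univ.pi fun _ : Fin n => Metric.closedBall (0 : ℂ) 1) :=
    isCompact_univ_pi fun _ => isCompact_closedBall _ _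
  obtain ⟨B, hB⟩ := hK.exists_bound_of_continuousOn (f := fun z => MvPolynomial.eval z p)
    (MvPolynomial.continuous_eval p).continuousOn
  refine ⟨B, ?_⟩
  rintro _ ⟨z, hz, rfl⟩
  exact hB z fun i _ => by simpa using hz i

theorem norm_eval_le_polydiscNorm {n : ℕ} (p : MvPolynomial (Fin n) ℂ) {z : Fin n → ℂ}
    (hz : ∀ i, ‖z i‖ ≤ 1) : ‖MvPolynomial.eval z p‖ ≤ polydiscNorm p :=
  le_csSup (bddAbove_polydisc p) ⟨z, hz, rfl⟩

open MvPolynomial in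
/-- If the multiplication is bounded by `2 C` for the injective tensor norm, then the von Neumann
inequality holds for elements of norm at most `1 / (e (1 + C))`. The factor `2` is compensated by
the polarization constant `e / 2` of the polydisc. -/
theorem IsInjectiveMulBound.satisfiesVonNeumannInequality (hC : 0 ≤ C)
    (hA : IsInjectiveMulBound A (2 * C)) :
    SatisfiesVonNeumannInequality A ((Real.exp 1)⁻¹ * (1 + C)⁻¹) 1 := by
  intro n a ha p hp0
  set δ := (Real.exp 1)⁻¹ * (1 + C)⁻¹ with hδ
  have hδ0 : 0 < δ := by positivity
  set N := polydiscNorm p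
  have hN : ∀ z : Fin n → ℂ, (∀ i, ‖z i‖ = 1) → ‖eval z p‖ ≤ N :=
    fun z hz => norm_eval_le_polydiscNorm p fun i => (hz i).le
  have hN0 : 0 ≤ N := (norm_nonneg _).trans (hN (fun _ => 1) fun _ => by simp)
  set a' : Fin n → A := fun i => ((δ : ℂ)⁻¹) • a i with ha'
  have hnorm : ‖(δ : ℂ)‖ = δ := by
    rw [Complex.norm_real, Real.norm_eq_abs, abs_of_pos hδ0]
  have ha1 : ∀ i, ‖a' i‖ ≤ 1 := fun i => by
    rw [ha', norm_smul, norm_inv, hnorm, inv_mul_le_iff₀ hδ0, mul_one]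
    exact ha i
  have haa : a = fun i => (δ : ℂ) • a' i := by
    ext i
    rw [ha', smul_inv_smul₀ (by exact_mod_cast hδ0.ne')]
  have hcomp : ∀ k, ‖aeval a (homogeneousComponent (k + 1) p)‖ ≤
      ((1 + C)⁻¹ * N) * (C / (1 + C)) ^ k := by
    intro k
    have hom := homogeneousComponent_isHomogeneous (k + 1) p
    have h := hA.norm_aeval_homogeneous_le k n _ hom N
      (fun z hz => norm_eval_homogeneousComponent_le hN (k + 1) hz) a' ha1
    rw [haa, IsHomogeneous.aeval_smul hom, norm_smul, norm_pow, hnorm]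
    calc δ ^ (k + 1) * ‖aeval a' (homogeneousComponent (k + 1) p)‖
        ≤ δ ^ (k + 1) * ((Real.exp 1 / 2 * (2 * C)) ^ k * N) := by gcongr
      _ = (δ * (Real.exp 1 / 2 * (2 * C))) ^ k * (δ * N) := by rw [mul_pow]; ring
      _ = (C / (1 + C)) ^ k * (δ * N) := by
        have : δ * (Real.exp 1 / 2 * (2 * C)) = C / (1 + C) := by
          rw [hδ]; field_simp
        rw [this]
      _ ≤ (C / (1 + C)) ^ k * ((1 + C)⁻¹ * N) := by
        gcongr
        exact mul_le_of_le_one_left (by positivity)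
          (inv_le_one_of_one_le₀ (Real.one_le_exp zero_le_one))
      _ = _ := mul_comm _ _
  have hsum : aeval a p = ∑ k ∈ Finset.range p.totalDegree,
      aeval a (homogeneousComponent (k + 1) p) := by
    conv_lhs => rw [← sum_homogeneousComponent p, Finset.sum_range_succ']
    rw [map_add, map_sum, homogeneousComponent_zero]
    have : coeff 0 p = 0 := by rw [← hp0]; rfl
    simp [this]
  have hq1 : C / (1 + C) < 1 := by rw [div_lt_one (by positivity)]; linarith
  rw [hsum, one_mul]
  calc ‖∑ k ∈ Finset.range p.totalDegree, aeval a (homogeneousComponent (k + 1) p)‖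
      ≤ ∑ k ∈ Finset.range p.totalDegree, ((1 + C)⁻¹ * N) * (C / (1 + C)) ^ k :=
        norm_sum_le_of_le _ fun k _ => hcomp k
    _ = ((1 + C)⁻¹ * N) * ∑ k ∈ Finset.range p.totalDegree, (C / (1 + C)) ^ k := by
        rw [Finset.mul_sum]
    _ ≤ ((1 + C)⁻¹ * N) * (1 - C / (1 + C))⁻¹ := by
        gcongr
        rw [← tsum_geometric_of_lt_one (by positivity) hq1]
        exact (summable_geometric_of_lt_one (by positivity) hq1).sum_le_tsum _
          fun _ _ => by positivity
    _ = N := by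
        have : 1 - C / (1 + C) = (1 + C)⁻¹ := by field_simp; ring
        rw [this]
        field_simp

end

/-! ### The von Neumann inequality and `Q`-algebras -/

/-- The closed unit disc. -/
abbrev ClosedDisc : Type := ↥(Metric.closedBall (0 : ℂ) 1)

instance : CompactSpace ClosedDisc := isCompact_iff_compactSpace.1 (isCompact_closedBall _ _)

/-- The polydisc with one coordinate for each element of `A` of norm at most `δ`. -/
abbrev BallPolydisc (A : Type u) [Norm A] (δ : ℝ) : Type u := {a : A // ‖a‖ ≤ δ} → ClosedDisc

/-- The polynomials as functions on `BallPolydisc A δ`. -/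
noncomputable def polydiscPolynomialHom (A : Type u) [Norm A] (δ : ℝ) :
    MvPolynomial {a : A // ‖a‖ ≤ δ} ℂ →ₐ[ℂ] C(BallPolydisc A δ, ℂ) :=
  MvPolynomial.aeval fun a => ⟨fun z => (z a : ℂ), by fun_prop⟩

theorem polydiscPolynomialHom_apply {A : Type u} [Norm A] {δ : ℝ}
    (p : MvPolynomial {a : A // ‖a‖ ≤ δ} ℂ) (z : BallPolydisc A δ) :
    polydiscPolynomialHom A δ p z = MvPolynomial.eval (fun a => (z a : ℂ)) p := by
  induction p using MvPolynomial.induction_on with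
  | C c => simp [polydiscPolynomialHom]
  | add p q hp hq => simp [hp, hq]
  | mul_X p a hp =>
    rw [map_mul, map_mul, ContinuousMap.mul_apply, hp]
    simp [polydiscPolynomialHom]

/-- The uniform closure of the polynomials: the polydisc algebra in possibly infinitely many
variables. -/
noncomputable def polydiscAlgebra (A : Type u) [Norm A] (δ : ℝ) : Subalgebra ℂ C(BallPolydisc A δ, ℂ) :=
  (polydiscPolynomialHom A δ).range.topologicalClosure

theorem isUniformAlgebra_polydiscAlgebra (A : Type u) [Norm A] (δ : ℝ) :
    IsUniformAlgebra (polydiscAlgebra A δ) where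
  isClosed := Subalgebra.isClosed_topologicalClosure _
  separatesPoints := by
    intro z w hzw
    obtain ⟨a, ha⟩ := Function.ne_iff.1 hzw
    refine ⟨_, ⟨polydiscPolynomialHom A δ (MvPolynomial.X a),
      Subalgebra.le_topologicalClosure _ ⟨_, rfl⟩, rfl⟩, ?_⟩
    simpa [polydiscPolynomialHom] using fun h => ha (Subtype.ext h)

theorem norm_eval_le_norm_polydiscPolynomialHom {A : Type u} [Norm A] {δ : ℝ}
    (p : MvPolynomial {a : A // ‖a‖ ≤ δ} ℂ)
    {z : {a : A // ‖a‖ ≤ δ} → ℂ} (hz : ∀ a, ‖z a‖ ≤ 1) :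
    ‖MvPolynomial.eval z p‖ ≤ ‖polydiscPolynomialHom A δ p‖ := by
  have h := (polydiscPolynomialHom A δ p).norm_coe_le_norm
    (fun a => ⟨z a, by simpa using hz a⟩)
  rwa [polydiscPolynomialHom_apply] at h

section

variable {A : Type u} [NormedCommRing A] [NormedAlgebra ℂ A] {δ : ℝ}

/-- A bounded homomorphism onto `A` along which the elements of `A` can be lifted with control of
the norm identifies `A` with the quotient by the kernel. -/
theorem isIsomorphicToQuotientOf_of_lift {B : Type u} [NormedCommRing B] [NormedAlgebra ℂ B]
    (Ψ : B →ₐ[ℂ] A) (hcont : Continuous Ψ) {C D : ℝ} (hΨ : ∀ u, ‖Ψ u‖ ≤ C * ‖u‖)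
    (hlift : ∀ a : A, ∃ u : B, Ψ u = a ∧ ‖u‖ ≤ D * ‖a‖) : IsIsomorphicToQuotientOf A B := by
  have hsurj : Function.Surjective Ψ := fun a => (hlift a).imp fun _ h => h.1
  refine ⟨RingHom.ker Ψ, ?_, (Ideal.quotientKerAlgEquivOfSurjective hsurj).symm,
    max 1 (max C D), fun a => ⟨?_, ?_⟩⟩
  · have : (RingHom.ker Ψ : Set B) = Ψ ⁻¹' {0} := by
      ext u; exact RingHom.mem_ker
    rw [this]
    exact isClosed_singleton.preimage hcont
  · obtain ⟨u, rfl, hu⟩ := hlift a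
    have h1 : (Ideal.quotientKerAlgEquivOfSurjective hsurj).symm (Ψ u) =
        Ideal.Quotient.mk (RingHom.ker Ψ) u := by
      rw [AlgEquiv.symm_apply_eq]
      rfl
    rw [h1]
    refine (Ideal.Quotient.norm_mk_le (I := RingHom.ker Ψ) u).trans (hu.trans ?_)
    gcongr
    exact (le_max_right _ _).trans (le_max_right _ _)
  · obtain ⟨x, rfl⟩ := (Ideal.quotientKerAlgEquivOfSurjective hsurj).surjective a
    rw [AlgEquiv.symm_apply_apply]
    refine le_of_forall_pos_le_add fun ε hε => ?_
    set E := max 1 (max C D)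
    have hE : 0 < E := lt_max_of_lt_left one_pos
    obtain ⟨u, rfl, hu⟩ := Ideal.Quotient.norm_mk_lt x (show 0 < ε / E by positivity)
    have h1 : Ideal.quotientKerAlgEquivOfSurjective hsurj
        (Ideal.Quotient.mk (RingHom.ker Ψ) u) = Ψ u := rfl
    rw [h1]
    calc ‖Ψ u‖ ≤ C * ‖u‖ := hΨ u
      _ ≤ E * ‖u‖ := by
        gcongr
        exact (le_max_left _ _).trans (le_max_right _ _)
      _ ≤ E * (‖Ideal.Quotient.mk (RingHom.ker Ψ) u‖ + ε / E) := by gcongr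
      _ = _ := by field_simp

/-- The constant term is treated separately: it is the value at the centre of the polydisc. -/
theorem SatisfiesVonNeumannInequality.norm_aeval_le (hA : SatisfiesVonNeumannInequality A δ 1)
    (p : MvPolynomial {a : A // ‖a‖ ≤ δ} ℂ) :
    ‖MvPolynomial.aeval (fun a : {a : A // ‖a‖ ≤ δ} => (a : A)) p‖ ≤
      (2 + ‖(1 : A)‖) * ‖polydiscPolynomialHom A δ p‖ := by
  set c := MvPolynomial.constantCoeff p with hc
  set N := ‖polydiscPolynomialHom A δ p‖
  have hcN : ‖c‖ ≤ N := by
    have h := norm_eval_le_norm_polydiscPolynomialHom p (z := 0) (by simp)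
    rwa [MvPolynomial.eval_zero] at h
  obtain ⟨n, g, hg, q, hq⟩ := MvPolynomial.exists_fin_rename (p - MvPolynomial.C c)
  have hq0 : MvPolynomial.constantCoeff q = 0 := by
    have h := congrArg MvPolynomial.constantCoeff hq
    rw [map_sub, MvPolynomial.constantCoeff_C, ← hc, sub_self,
      MvPolynomial.constantCoeff_rename] at h
    exact h.symm
  have hvn := hA n (fun i => (g i : A)) (fun i => (g i).2) q hq0
  have hN : polydiscNorm q ≤ 2 * N := by
    refine csSup_le ⟨_, 0, by simp, rfl⟩ ?_
    rintro _ ⟨z, hz, rfl⟩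
    have he : MvPolynomial.eval z q = MvPolynomial.eval (Function.extend g z 0) p - c := by
      have h := congrArg (MvPolynomial.eval (Function.extend g z 0)) hq
      rw [MvPolynomial.eval_rename, map_sub, MvPolynomial.eval_C,
        Function.extend_comp hg] at h
      exact h.symm
    rw [he]
    have h1 := norm_eval_le_norm_polydiscPolynomialHom p (z := Function.extend g z 0) fun a => by
      by_cases ha : ∃ i, g i = a
      · obtain ⟨i, rfl⟩ := ha
        rw [hg.extend_apply]; exact hz i
      · rw [Function.extend_apply' _ _ _ ha]; simp
    have h2 := norm_sub_le (MvPolynomial.eval (Function.extend g z 0) p) c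
    linarith
  have hp : MvPolynomial.aeval (fun a : {a : A // ‖a‖ ≤ δ} => (a : A)) p =
      MvPolynomial.aeval (fun i => (g i : A)) q + c • (1 : A) := by
    have h := congrArg (MvPolynomial.aeval (fun a : {a : A // ‖a‖ ≤ δ} => (a : A))) hq
    rw [MvPolynomial.aeval_rename, map_sub, MvPolynomial.aeval_C, sub_eq_iff_eq_add] at h
    rw [h, Algebra.algebraMap_eq_smul_one]
    rfl
  rw [hp]
  refine (norm_add_le _ _).trans ?_
  have h3 := norm_smul_le c (1 : A)
  have h4 := mul_le_mul_of_nonneg_right hcN (norm_nonneg (1 : A))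
  linarith

/-- A complete commutative algebra with a von Neumann inequality is a quotient of the polydisc
algebra whose variables are indexed by a ball: the evaluation of polynomials is continuous for the
supremum norm, hence extends to the closure, and the coordinate functions are mapped onto the
ball. -/
theorem SatisfiesVonNeumannInequality.isIsomorphicToQAlgebra [CompleteSpace A] (hδ : 0 < δ)
    (hA : SatisfiesVonNeumannInequality A δ 1) : IsIsomorphicToQAlgebra A := by
  refine ⟨BallPolydisc A δ, inferInstance, inferInstance, inferInstance, polydiscAlgebra A δ,
    isUniformAlgebra_polydiscAlgebra A δ, ?_⟩
  set U := polydiscAlgebra A δ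
  let e : MvPolynomial {a : A // ‖a‖ ≤ δ} ℂ →ₐ[ℂ] U :=
    (polydiscPolynomialHom A δ).codRestrict U
      fun p => Subalgebra.le_topologicalClosure _ ⟨p, rfl⟩
  have hdense : DenseRange e.toLinearMap := by
    intro u
    rw [closure_subtype]
    have h : (u : C(BallPolydisc A δ, ℂ)) ∈
        closure ((polydiscPolynomialHom A δ).range : Set C(BallPolydisc A δ, ℂ)) := u.2
    refine closure_mono ?_ h
    rintro _ ⟨p, rfl⟩
    exact ⟨e p, ⟨p, rfl⟩, rfl⟩
  let ev : MvPolynomial {a : A // ‖a‖ ≤ δ} ℂ →ₐ[ℂ] A :=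
    MvPolynomial.aeval (fun a : {a : A // ‖a‖ ≤ δ} => (a : A))
  have hbound : ∀ p, ‖ev.toLinearMap p‖ ≤ (2 + ‖(1 : A)‖) * ‖e.toLinearMap p‖ := hA.norm_aeval_le
  let Φ : U →L[ℂ] A := ev.toLinearMap.extendOfNorm e.toLinearMap
  have hΦe : ∀ p, Φ (e p) = ev p := LinearMap.extendOfNorm_eq hdense ⟨_, hbound⟩
  have hΦ : ∀ u, ‖Φ u‖ ≤ (2 + ‖(1 : A)‖) * ‖u‖ :=
    LinearMap.norm_extendOfNorm_apply_le hdense _ hbound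
  have hmul : ∀ u v, Φ (u * v) = Φ u * Φ v := by
    intro u v
    refine hdense.induction_on₂ (p := fun u v => Φ (u * v) = Φ u * Φ v)
      (isClosed_eq (by fun_prop) (by fun_prop)) (fun p q => ?_) u v
    change Φ (e p * e q) = Φ (e p) * Φ (e q)
    rw [← map_mul, hΦe, hΦe, hΦe, map_mul]
  let Ψ : U →ₐ[ℂ] A := AlgHom.ofLinearMap Φ.toLinearMap
    (by change Φ 1 = 1; rw [← map_one e, hΦe, map_one]) hmul
  -- every element of `A` is a multiple of the image of a coordinate function
  have hlift : ∀ a : A, ∃ u : U, Ψ u = a ∧ ‖u‖ ≤ δ⁻¹ * ‖a‖ := by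
    intro a
    rcases eq_or_ne a 0 with rfl | ha
    · exact ⟨0, map_zero _, by simp⟩
    have ha' : 0 < ‖a‖ := norm_pos_iff.2 ha
    have hs : ‖((δ / ‖a‖ : ℝ) : ℂ) • a‖ ≤ δ := by
      rw [norm_smul, Complex.norm_real, Real.norm_eq_abs, abs_of_pos (by positivity)]
      field_simp
      exact le_rfl
    refine ⟨((‖a‖ / δ : ℝ) : ℂ) • e (MvPolynomial.X ⟨_, hs⟩), ?_, ?_⟩
    · rw [map_smul]
      change _ • Φ (e _) = a
      rw [hΦe]
      simp only [ev, MvPolynomial.aeval_X, smul_smul]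
      rw [← Complex.ofReal_mul]
      have : ‖a‖ / δ * (δ / ‖a‖) = 1 := by field_simp
      rw [this, Complex.ofReal_one, one_smul]
    · refine (norm_smul_le _ _).trans ?_
      rw [Complex.norm_real, Real.norm_eq_abs, abs_of_pos (by positivity)]
      have h1 : ‖e (MvPolynomial.X ⟨_, hs⟩)‖ ≤ 1 := by
        change ‖polydiscPolynomialHom A δ (MvPolynomial.X ⟨_, hs⟩)‖ ≤ 1
        refine (ContinuousMap.norm_le _ zero_le_one).2 fun z => ?_
        rw [polydiscPolynomialHom_apply, MvPolynomial.eval_X]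
        exact mem_closedBall_zero_iff.1 (z _).2
      calc ‖a‖ / δ * ‖e (MvPolynomial.X ⟨_, hs⟩)‖ ≤ ‖a‖ / δ * 1 := by gcongr
        _ = δ⁻¹ * ‖a‖ := by rw [mul_one, div_eq_inv_mul]
  exact isIsomorphicToQuotientOf_of_lift Ψ Φ.continuous hΦ hlift

end

/-! ### Grothendieck's inequality for kernels -/

/-- Minkowski's inequality: an absolutely convex combination of vectors of
`ℓ²`-norm at most `R` has norm at most `R`. -/
theorem sum_norm_sum_mul_sq_le {ι κ : Type*} [Fintype ι] [Fintype κ] {α : κ → ℂ}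
    (hα : ∑ y, ‖α y‖ ≤ 1) {P : ι → κ → ℂ} {R : ℝ} (hP : ∀ y, ∑ x, ‖P x y‖ ^ 2 ≤ R ^ 2) :
    ∑ x, ‖∑ y, α y * P x y‖ ^ 2 ≤ R ^ 2 := by
  have h : ∀ x, ‖∑ y, α y * P x y‖ ^ 2 ≤ ∑ y, ‖α y‖ * ‖P x y‖ ^ 2 := by
    intro x
    have h1 : ‖∑ y, α y * P x y‖ ≤ ∑ y, ‖α y‖ * ‖P x y‖ :=
      norm_sum_le_of_le _ fun y _ => (norm_mul _ _).le
    have h2 : (∑ y, Real.sqrt ‖α y‖ * (Real.sqrt ‖α y‖ * ‖P x y‖)) ^ 2 ≤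
        (∑ y, Real.sqrt ‖α y‖ ^ 2) * ∑ y, (Real.sqrt ‖α y‖ * ‖P x y‖) ^ 2 :=
      Finset.sum_mul_sq_le_sq_mul_sq _ _ _
    simp only [← mul_assoc, mul_pow, Real.mul_self_sqrt (norm_nonneg _),
      Real.sq_sqrt (norm_nonneg _)] at h2
    have h3 : 0 ≤ ∑ y, ‖α y‖ * ‖P x y‖ ^ 2 := Finset.sum_nonneg fun y _ => by positivity
    calc ‖∑ y, α y * P x y‖ ^ 2 ≤ (∑ y, ‖α y‖ * ‖P x y‖) ^ 2 := by gcongr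
      _ ≤ _ := h2
      _ ≤ _ := mul_le_of_le_one_left h3 hα
  calc ∑ x, ‖∑ y, α y * P x y‖ ^ 2 ≤ ∑ x, ∑ y, ‖α y‖ * ‖P x y‖ ^ 2 :=
        Finset.sum_le_sum fun x _ => h x
    _ = ∑ y, ‖α y‖ * ∑ x, ‖P x y‖ ^ 2 := by
        rw [Finset.sum_comm]
        simp only [Finset.mul_sum]
    _ ≤ ∑ y, ‖α y‖ * R ^ 2 := by
        gcongr with y _
        exact hP y
    _ = (∑ y, ‖α y‖) * R ^ 2 := by rw [Finset.sum_mul]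
    _ ≤ R ^ 2 := mul_le_of_le_one_left (sq_nonneg _) hα

section

variable {I J κ : Type*} [Fintype I] [Fintype J] [Fintype κ] {K R : ℝ}
  {m : I → J → ℂ} {α : J → κ → ℂ}

/-- A kernel whose columns are bounded in `ℓ²`. -/
theorem IsGrothendieckBound.norm_sum_kernel_le_of_columns (hK : IsGrothendieckBound K)
    (hm : IsContractiveForm m) (hα : ∀ j, ∑ y, ‖α j y‖ ≤ 1) (hR : 0 < R) {P : I → κ → ℂ}
    (hP : ∀ y, ∑ x, ‖P x y‖ ^ 2 ≤ R ^ 2) :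
    ‖∑ x, ∑ j, m x j * ∑ y, α j y * P x y‖ ≤ K * R := by
  classical
  have h := hK.norm_sum_le hm (fun x w => if w = x then (1 : ℂ) else 0)
    (fun j w => ∑ y, α j y * P w y) one_pos hR
    (fun x => by
      rw [Finset.sum_eq_single x (fun w _ hw => by simp [hw]) (by simp)]
      simp)
    (fun j => sum_norm_sum_mul_sq_le (hα j) hP)
  simpa [apply_ite (starRingEnd ℂ)] using h

/-- A kernel whose rows are bounded in `ℓ²`. -/
theorem IsGrothendieckBound.norm_sum_kernel_le_of_rows (hK : IsGrothendieckBound K)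
    (hm : IsContractiveForm m) (hα : ∀ j, ∑ y, ‖α j y‖ ≤ 1) (hR : 0 < R) {Q : I → κ → ℂ}
    (hQ : ∀ x, ∑ y, ‖Q x y‖ ^ 2 ≤ R ^ 2) :
    ‖∑ x, ∑ j, m x j * ∑ y, α j y * Q x y‖ ≤ K * R := by
  have h := hK.norm_sum_le hm (fun x y => (starRingEnd ℂ) (Q x y)) α hR one_pos
    (fun x => by simpa only [RCLike.norm_conj] using hQ x)
    (fun j => by
      have h1 : ∀ y ∈ Finset.univ, ‖α j y‖ ^ 2 ≤ ‖α j y‖ := fun y _ => by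
        have : ‖α j y‖ ≤ 1 := (Finset.single_le_sum (f := fun y => ‖α j y‖)
          (fun y _ => norm_nonneg _) (Finset.mem_univ y)).trans (hα j)
        nlinarith [norm_nonneg (α j y)]
      rw [one_pow]
      exact (Finset.sum_le_sum h1).trans (hα j))
  simpa only [Complex.conj_conj, mul_comm (α _ _), mul_one] using h

end

/-! ### Point masses and completeness of the weighted group algebra -/

namespace WeightedL1

variable {G : Type*} [Group G] {ω : GroupWeight G}

/-- `f ↦ f ω` is an isometry of `ℓ¹(G, ω)` onto `ℓ¹(G)`. -/
instance : CompleteSpace (WeightedL1 ω) := by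
  have hp : (0 : ℝ) < (1 : ENNReal).toReal := by simp
  let e : WeightedL1 ω ≃ᵢ lp (fun _ : G => ℂ) 1 :=
    { toFun := fun f => ⟨fun x => f x * ω.toFun x, memℓp_gen (by
        simpa [abs_of_pos (ω.pos _)] using f.summable)⟩
      invFun := fun g => ⟨fun x => g x / ω.toFun x, by
        have h := (memℓp_gen_iff hp).1 (lp.memℓp g)
        simp only [ENNReal.toReal_one, Real.rpow_one] at h
        refine h.congr fun x => ?_
        have := (ω.pos x).ne'
        rw [norm_div, Complex.norm_real, Real.norm_eq_abs, abs_of_pos (ω.pos x)]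
        field_simp⟩
      left_inv := fun f => by
        ext x
        have : (ω.toFun x : ℂ) ≠ 0 := by exact_mod_cast (ω.pos x).ne'
        change f x * ω.toFun x / ω.toFun x = f x
        field_simp
      right_inv := fun g => by
        ext x
        have : (ω.toFun x : ℂ) ≠ 0 := by exact_mod_cast (ω.pos x).ne'
        change g x / ω.toFun x * ω.toFun x = g x
        field_simp
      isometry_toFun := by
        refine Isometry.of_dist_eq fun f g => ?_
        rw [dist_eq_norm, dist_eq_norm, lp.norm_eq_tsum_rpow hp, norm_def]
        simp only [ENNReal.toReal_one, Real.rpow_one, div_one]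
        refine tsum_congr fun x => ?_
        change ‖f x * ω.toFun x - g x * ω.toFun x‖ = ‖(f - g) x‖ * ω.toFun x
        rw [← sub_mul, norm_mul, Complex.norm_real, Real.norm_eq_abs, abs_of_pos (ω.pos x)]
        rfl }
  exact e.completeSpace_iff.2 inferInstance

open Classical in
/-- The point mass at `x`. -/
noncomputable def single (ω : GroupWeight G) (x : G) : WeightedL1 ω :=
  ⟨fun y => if y = x then 1 else 0,
    summable_of_ne_finset_zero (s := {x}) (fun y hy => by
      have : y ≠ x := by simpa using hy
      simp [this])⟩

open Classical in
theorem single_apply (x y : G) : single ω x y = if y = x then 1 else 0 := rfl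

theorem single_mul_single (x y : G) : single ω x * single ω y = single ω (x * y) := by
  ext z
  rw [mul_apply, tsum_eq_single x]
  · have : x⁻¹ * z = y ↔ z = x * y := inv_mul_eq_iff_eq_mul
    by_cases h : z = x * y <;> simp [single_apply, this, h]
  · intro w hw
    simp [single_apply, hw]

theorem sum_apply {ι : Type*} (s : Finset ι) (f : ι → WeightedL1 ω) (x : G) :
    (∑ i ∈ s, f i) x = ∑ i ∈ s, f i x := by
  classical
  induction s using Finset.induction_on with
  | empty => rfl
  | insert i s hi ih => rw [Finset.sum_insert hi, Finset.sum_insert hi, add_apply, ih]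

theorem hasSum_single (f : WeightedL1 ω) : HasSum (fun x => f x • single ω x) f := by
  classical
  rw [HasSum, tendsto_iff_norm_sub_tendsto_zero]
  refine (tendsto_tsum_compl_atTop_zero fun x => ‖f x‖ * ω.toFun x).congr fun s => ?_
  rw [norm_def]
  have h := tsum_subtype {x | x ∉ s} fun x => ‖f x‖ * ω.toFun x
  refine h.trans (tsum_congr fun x => ?_)
  have hs : (∑ y ∈ s, f y • single ω y) x = if x ∈ s then f x else 0 := by
    rw [sum_apply]
    simp [single_apply]
  rw [sub_eq_add_neg, add_apply, neg_apply, hs]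
  by_cases hx : x ∈ s <;> simp [hx, Set.indicator]

/-- The functional `f ↦ ∑ f(x) φ(x) ω(x)` given by a bounded function `φ`. -/
noncomputable def pairing {φ : G → ℂ} (hφ : ∀ x, ‖φ x‖ ≤ 1) : WeightedL1 ω →ₗ[ℂ] ℂ :=
  have hs : ∀ f : WeightedL1 ω, Summable fun x => f x * (φ x * ω.toFun x) := fun f =>
    Summable.of_norm_bounded f.summable fun x => by
      rw [norm_mul, norm_mul, Complex.norm_real, Real.norm_eq_abs, abs_of_pos (ω.pos x)]
      have := mul_le_of_le_one_left (ω.pos x).le (hφ x)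
      gcongr
  { toFun := fun f => ∑' x, f x * (φ x * ω.toFun x)
    map_add' := fun f g => by
      rw [← (hs f).tsum_add (hs g)]
      exact tsum_congr fun x => by rw [add_apply, add_mul]
    map_smul' := fun c f => by
      rw [RingHom.id_apply, smul_eq_mul, ← tsum_mul_left]
      exact tsum_congr fun x => by rw [smul_apply, mul_assoc] }

theorem pairing_single {φ : G → ℂ} (hφ : ∀ x, ‖φ x‖ ≤ 1) (x : G) :
    pairing hφ (single ω x) = φ x * ω.toFun x := by
  change ∑' y, single ω x y * (φ y * ω.toFun y) = _
  rw [tsum_eq_single x fun y hy => by simp [single_apply, hy]]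
  simp [single_apply]

theorem exists_pairing_eq_norm (f : WeightedL1 ω) :
    ∃ (φ : G → ℂ) (hφ : ∀ x, ‖φ x‖ ≤ 1), pairing hφ f = ‖f‖ := by
  refine ⟨fun x => (starRingEnd ℂ) (f x) / ‖f x‖, fun x => ?_, ?_⟩
  · rw [norm_div, RCLike.norm_conj, Complex.norm_real, norm_norm]
    exact div_self_le_one _
  · change ∑' x, f x * ((starRingEnd ℂ) (f x) / ‖f x‖ * ω.toFun x) = _
    rw [norm_def, Complex.ofReal_tsum]
    refine tsum_congr fun x => ?_
    rcases eq_or_ne (f x) 0 with h | h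
    · simp [h]
    · have : (‖f x‖ : ℂ) ≠ 0 := by simpa using h
      have h2 := Complex.mul_conj' (f x)
      push_cast
      field_simp
      rw [h2]

end WeightedL1

/-! ### Injectivity of the multiplication -/

section

variable {G : Type*} [Group G] {ω : GroupWeight G} {D S K : ℝ}

/-- For a weight with `ω(xy) ≤ D (ω(x) + ω(y))`, the normalized multiplication kernel
`ω(xy) / (ω(x) ω(y))` is split into a part with columns in `ℓ²` and a part with rows in `ℓ²`, and
Grothendieck's inequality is applied to each of them. -/
theorem GroupWeight.norm_sum_kernel_le (hK : IsGrothendieckBound K) (hD : 0 < D) (hS : 0 < S)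
    (hω : ∀ x y, ω.toFun (x * y) ≤ D * (ω.toFun x + ω.toFun y))
    (hωS : ∀ X : Finset G, ∑ x ∈ X, (ω.toFun x)⁻¹ ^ 2 ≤ S ^ 2)
    {φ : G → ℂ} (hφ : ∀ x, ‖φ x‖ ≤ 1) (X Y : Finset G) {n : ℕ} (b a : Fin n → G → ℂ) {N : ℝ}
    (hN : 0 < N)
    (hb : ∀ t : Fin n → ℂ, (∀ j, ‖t j‖ ≤ 1) → ∑ x ∈ X, ‖∑ j, t j * b j x‖ * ω.toFun x ≤ N)
    (ha : ∀ j, ∑ y ∈ Y, ‖a j y‖ * ω.toFun y ≤ 1) :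
    ‖∑ x ∈ X, ∑ j, b j x * ∑ y ∈ Y, a j y * (φ (x * y) * ω.toFun (x * y))‖ ≤
      2 * (K * (D * S)) * N := by
  -- `θ = P + Q` with `‖P x y‖ ≤ D / ω x` and `‖Q x y‖ ≤ D / ω y`
  let m : X → Fin n → ℂ := fun x j => b j x * ω.toFun x / N
  let α : Fin n → Y → ℂ := fun j y => a j y * ω.toFun y
  let θ : G → G → ℂ := fun x y => φ (x * y) * (ω.toFun (x * y) : ℂ) / (ω.toFun x * ω.toFun y)
  let P : X → Y → ℂ := fun x y => θ x y * (ω.toFun y / (ω.toFun x + ω.toFun y) : ℝ)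
  let Q : X → Y → ℂ := fun x y => θ x y * (ω.toFun x / (ω.toFun x + ω.toFun y) : ℝ)
  have hpos := ω.pos
  have hm : IsContractiveForm m := by
    intro s t hs ht
    have h1 : ∀ x, ‖∑ j, m x j * s x * t j‖ ≤ ‖∑ j, t j * b j x‖ * ω.toFun x / N := by
      intro x
      have h2 : ∑ j, m x j * s x * t j = s x * ((∑ j, t j * b j x) * ω.toFun x / N) := by
        rw [Finset.sum_mul, Finset.sum_div, Finset.mul_sum]
        exact Finset.sum_congr rfl fun j _ => by simp only [m]; ring
      rw [h2, norm_mul, norm_div, norm_mul, Complex.norm_real, Complex.norm_real,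
        Real.norm_eq_abs, Real.norm_eq_abs, abs_of_pos (hpos _), abs_of_pos hN]
      have := hpos x
      exact mul_le_of_le_one_left (by positivity) (hs x)
    refine (norm_sum_le_of_le _ fun x _ => h1 x).trans ?_
    rw [← Finset.sum_div, div_le_one hN,
      Finset.sum_coe_sort X fun x => ‖∑ j, t j * b j x‖ * ω.toFun x]
    exact hb t ht
  have hα : ∀ j, ∑ y, ‖α j y‖ ≤ 1 := by
    intro j
    refine le_trans (le_of_eq ?_) (ha j)
    rw [← Finset.sum_coe_sort Y]
    refine Finset.sum_congr rfl fun y _ => ?_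
    rw [norm_mul, Complex.norm_real, Real.norm_eq_abs, abs_of_pos (hpos _)]
  have hθ : ∀ x y, ‖θ x y‖ ≤ D * (ω.toFun x + ω.toFun y) / (ω.toFun x * ω.toFun y) := by
    intro x y
    have hx := hpos x
    have hy := hpos y
    rw [norm_div, norm_mul, norm_mul, Complex.norm_real, Complex.norm_real, Complex.norm_real,
      Real.norm_eq_abs, Real.norm_eq_abs, Real.norm_eq_abs, abs_of_pos hx, abs_of_pos hy,
      abs_of_pos (hpos _)]
    exact div_le_div_of_nonneg_right
      ((mul_le_of_le_one_left (hpos _).le (hφ _)).trans (hω x y)) (by positivity)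
  have hP : ∀ x y, ‖P x y‖ ^ 2 ≤ D ^ 2 * (ω.toFun x)⁻¹ ^ 2 := by
    intro x y
    have hx := hpos x
    have hy := hpos y
    rw [← mul_pow]
    gcongr
    rw [norm_mul, Complex.norm_real, Real.norm_eq_abs, abs_of_pos (by positivity)]
    refine (mul_le_mul_of_nonneg_right (hθ x y) (by positivity)).trans (le_of_eq ?_)
    field_simp
  have hQ : ∀ x y, ‖Q x y‖ ^ 2 ≤ D ^ 2 * (ω.toFun y)⁻¹ ^ 2 := by
    intro x y
    have hx := hpos x
    have hy := hpos y
    rw [← mul_pow]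
    gcongr
    rw [norm_mul, Complex.norm_real, Real.norm_eq_abs, abs_of_pos (by positivity)]
    refine (mul_le_mul_of_nonneg_right (hθ x y) (by positivity)).trans (le_of_eq ?_)
    field_simp
  have hsum : ∀ Z : Finset G, ∑ z : Z, D ^ 2 * (ω.toFun z)⁻¹ ^ 2 ≤ (D * S) ^ 2 := by
    intro Z
    rw [← Finset.mul_sum, Finset.sum_coe_sort Z fun z => (ω.toFun z)⁻¹ ^ 2, mul_pow]
    exact mul_le_mul_of_nonneg_left (hωS Z) (by positivity)
  have h1 := hK.norm_sum_kernel_le_of_columns hm hα (mul_pos hD hS) (P := P)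
    fun y => (Finset.sum_le_sum fun x _ => hP x y).trans (hsum X)
  have h2 := hK.norm_sum_kernel_le_of_rows hm hα (mul_pos hD hS) (Q := Q)
    fun x => (Finset.sum_le_sum fun y _ => hQ x y).trans (hsum Y)
  have hsplit : ∑ x ∈ X, ∑ j, b j x * ∑ y ∈ Y, a j y * (φ (x * y) * ω.toFun (x * y)) =
      N * ((∑ x, ∑ j, m x j * ∑ y, α j y * P x y) + ∑ x, ∑ j, m x j * ∑ y, α j y * Q x y) := by
    rw [← Finset.sum_coe_sort X, ← Finset.sum_add_distrib, Finset.mul_sum]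
    refine Finset.sum_congr rfl fun x _ => ?_
    rw [← Finset.sum_add_distrib, Finset.mul_sum]
    refine Finset.sum_congr rfl fun j _ => ?_
    rw [← mul_add, ← Finset.sum_add_distrib, ← Finset.sum_coe_sort Y, ← mul_assoc,
      Finset.mul_sum, Finset.mul_sum]
    refine Finset.sum_congr rfl fun y _ => ?_
    have hx : (ω.toFun x : ℂ) ≠ 0 := by exact_mod_cast (hpos x).ne'
    have hy : (ω.toFun y : ℂ) ≠ 0 := by exact_mod_cast (hpos y).ne'
    have hxy : (ω.toFun x + ω.toFun y : ℂ) ≠ 0 := by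
      exact_mod_cast (add_pos (hpos x) (hpos y)).ne'
    have hN' : (N : ℂ) ≠ 0 := by exact_mod_cast hN.ne'
    simp only [m, α, P, Q, θ]
    push_cast
    field_simp
    ring
  rw [hsplit, norm_mul, Complex.norm_real, Real.norm_eq_abs, abs_of_pos hN]
  calc _ ≤ N * (K * (D * S) + K * (D * S)) := by
        gcongr
        exact (norm_add_le _ _).trans (add_le_add h1 h2)
    _ = _ := by ring

/-- By density of the finitely supported functions and duality, the norm of a sum of products is
estimated through the values of finite parts of the multiplication kernel. -/
theorem WeightedL1.isInjectiveMulBound (hK : IsGrothendieckBound K) (hD : 0 < D) (hS : 0 < S)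
    (hω : ∀ x y, ω.toFun (x * y) ≤ D * (ω.toFun x + ω.toFun y))
    (hωS : ∀ X : Finset G, ∑ x ∈ X, (ω.toFun x)⁻¹ ^ 2 ≤ S ^ 2) :
    IsInjectiveMulBound (WeightedL1 ω) (2 * (K * (D * S))) := by
  intro n b a N hb ha
  have hN0 : 0 ≤ N := (norm_nonneg _).trans (hb 0 (by simp))
  -- a positive bound is needed for normalization
  have key : ∀ N' > N, ‖∑ j, b j * a j‖ ≤ 2 * (K * (D * S)) * N' := by
    intro N' hN'
    have hlim : Filter.Tendsto (fun s : Finset G => ∑ j, (∑ x ∈ s, b j x • single ω x) *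
        (∑ y ∈ s, a j y • single ω y)) Filter.atTop (nhds (∑ j, b j * a j)) :=
      tendsto_finsetSum _ fun j _ =>
        Filter.Tendsto.mul (hasSum_single (b j)) (hasSum_single (a j))
    refine le_of_tendsto hlim.norm (Filter.Eventually.of_forall fun s => ?_)
    obtain ⟨φ, hφ, he⟩ := exists_pairing_eq_norm (∑ j, (∑ x ∈ s, b j x • single ω x) *
      (∑ y ∈ s, a j y • single ω y))
    have hexp : pairing hφ (∑ j, (∑ x ∈ s, b j x • single ω x) *
        (∑ y ∈ s, a j y • single ω y)) =
        ∑ x ∈ s, ∑ j, b j x * ∑ y ∈ s, a j y * (φ (x * y) * ω.toFun (x * y)) := by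
      rw [Finset.sum_comm, map_sum]
      refine Finset.sum_congr rfl fun j _ => ?_
      rw [Finset.sum_mul_sum, map_sum]
      refine Finset.sum_congr rfl fun x _ => ?_
      rw [map_sum, Finset.mul_sum]
      refine Finset.sum_congr rfl fun y _ => ?_
      rw [smul_mul_smul_comm, single_mul_single, map_smul, pairing_single, smul_eq_mul, mul_assoc]
    have hnorm : ‖∑ j, (∑ x ∈ s, b j x • single ω x) * (∑ y ∈ s, a j y • single ω y)‖ =
        ‖∑ x ∈ s, ∑ j, b j x * ∑ y ∈ s, a j y * (φ (x * y) * ω.toFun (x * y))‖ := by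
      rw [← hexp, he, Complex.norm_real, norm_norm]
    rw [hnorm]
    refine GroupWeight.norm_sum_kernel_le hK hD hS hω hωS hφ s s (fun j => b j) (fun j => a j)
      (hN0.trans_lt hN') (fun t ht => ?_) fun j => ?_
    · have h1 := (∑ j, t j • b j).summable.sum_le_tsum s fun x _ => term_nonneg _ x
      refine le_trans (le_of_eq ?_) ((h1.trans (hb t ht)).trans hN'.le)
      refine Finset.sum_congr rfl fun x _ => ?_
      rw [sum_apply]
      rfl
    · exact ((a j).summable.sum_le_tsum s fun x _ => term_nonneg _ x).trans (ha j)
  have hcont : Filter.Tendsto (fun N' => 2 * (K * (D * S)) * N') (nhdsWithin N (Set.Ioi N))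
      (nhds (2 * (K * (D * S)) * N)) :=
    ((continuous_const.mul continuous_id).tendsto N).mono_left nhdsWithin_le_nhds
  exact ge_of_tendsto hcont (Filter.eventually_of_mem self_mem_nhdsWithin key)

end

/-! ### The centre -/

section

variable {A : Type*} [NormedRing A] [NormedAlgebra ℂ A]

instance AlgCenter.completeSpace [CompleteSpace A] : CompleteSpace (AlgCenter A) := by
  have h : IsClosed ((Subalgebra.center ℂ A : Subalgebra ℂ A) : Set A) := by
    rw [show ((Subalgebra.center ℂ A : Subalgebra ℂ A) : Set A) = Set.centralizer Set.univ from
      (Set.centralizer_univ (M := A)).symm]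
    exact Set.isClosed_centralizer _
  exact h.completeSpace_coe

theorem IsInjectiveMulBound.algCenter {C : ℝ} (h : IsInjectiveMulBound A C) :
    IsInjectiveMulBound (AlgCenter A) C := by
  intro n b a N hb ha
  have h1 := h n (fun j => (b j : A)) (fun j => (a j : A)) N (fun t ht => by
    have h2 := hb t ht
    have h3 : ((∑ j, t j • b j : AlgCenter A) : A) = ∑ j, t j • (b j : A) := by
      simp
    rw [← h3]
    exact h2) ha
  have h3 : ((∑ j, b j * a j : AlgCenter A) : A) = ∑ j, (b j : A) * (a j : A) := by
    simp
  rw [← h3] at h1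
  exact h1

end

/-! ### Polynomial weights on groups of polynomial growth -/

theorem Real.add_rpow_le_max_mul {a b β : ℝ} (ha : 0 ≤ a) (hb : 0 ≤ b) (hβ : 0 ≤ β) :
    (a + b) ^ β ≤ max 1 ((2 : ℝ) ^ (β - 1)) * (a ^ β + b ^ β) := by
  have hab : 0 ≤ a ^ β + b ^ β := by positivity
  lift a to NNReal using ha
  lift b to NNReal using hb
  rcases le_total β 1 with h | h
  · have h1 : ((a : ℝ) + b) ^ β ≤ a ^ β + b ^ β := by
      exact_mod_cast NNReal.rpow_add_le_add_rpow a b hβ h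
    exact h1.trans (le_mul_of_one_le_left hab (le_max_left _ _))
  · have h1 : ((a : ℝ) + b) ^ β ≤ (2 : ℝ) ^ (β - 1) * (a ^ β + b ^ β) := by
      exact_mod_cast NNReal.rpow_add_le_mul_rpow_add_rpow a b h
    exact h1.trans (mul_le_mul_of_nonneg_right (le_max_right _ _) hab)

namespace SymmGenSet

variable {G : Type*} [Group G] (F : SymmGenSet G)

theorem polyWeight_mul_le (β : ℝ) (hβ : 0 ≤ β) (x y : G) :
    (F.polyWeight β hβ).toFun (x * y) ≤ max 1 ((2 : ℝ) ^ (β - 1)) *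
      ((F.polyWeight β hβ).toFun x + (F.polyWeight β hβ).toFun y) := by
  refine le_trans ?_ (Real.add_rpow_le_max_mul (by positivity) (by positivity) hβ)
  refine Real.rpow_le_rpow (by positivity) ?_ hβ
  have h : (F.length (x * y) : ℝ) ≤ F.length x + F.length y := by
    exact_mod_cast F.length_mul_le x y
  linarith

theorem finite_ball (n : ℕ) : (F.ball n).Finite := by
  classical
  rw [ball, ← Finset.coe_pow]
  exact Finset.finite_toSet _

theorem ball_mono : Monotone F.ball := fun _ _ h =>
  Set.pow_subset_pow_right F.one_mem h

theorem length_le_iff {x : G} {n : ℕ} : F.length x ≤ n ↔ x ∈ F.ball n :=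
  ⟨fun h => F.ball_mono h (F.mem_ball_length x), fun h => Nat.sInf_le h⟩

namespace IsGrowthPair

variable {F} {f : Polynomial ℝ} {lam : ℝ}

theorem ncard_sub_ncard_le (hf : F.IsGrowthPair f lam) (n : ℕ) :
    ((F.ball (n + 1)).ncard : ℝ) - (F.ball n).ncard ≤
      f.eval ((n : ℝ) + 1) - lam * f.eval (n : ℝ) := by
  have h1 := hf.upper (n + 1)
  have h2 := hf.lower n
  push_cast at h1
  linarith

theorem growthTerm_nonneg (hf : F.IsGrowthPair f lam) (β : ℝ) (n : ℕ) :
    0 ≤ growthTerm f lam β n := by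
  have h1 : ((F.ball n).ncard : ℝ) ≤ (F.ball (n + 1)).ncard := by
    exact_mod_cast Set.ncard_le_ncard (F.ball_mono n.le_succ) (F.finite_ball _)
  have h2 := hf.ncard_sub_ncard_le n
  exact div_nonneg (by linarith) (by positivity)

/-- Summation over spheres. -/
theorem sum_ball_le (hf : F.IsGrowthPair f lam) (β : ℝ) (hβ : 0 ≤ β) (n : ℕ) :
    ∑ x ∈ (F.finite_ball n).toFinset, ((F.polyWeight β hβ).toFun x)⁻¹ ^ 2 ≤
      1 + ∑ k ∈ Finset.range n, growthTerm f lam β k := by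
  classical
  induction n with
  | zero =>
    have h0 : (F.finite_ball 0).toFinset = {1} := by
      ext x; simp [ball]
    have h1 : F.length 1 = 0 := by
      rw [← Nat.le_zero, length_le_iff]; simp [ball]
    simp [h0, polyWeight, h1]
  | succ n ih =>
    have hsub : (F.finite_ball n).toFinset ⊆ (F.finite_ball (n + 1)).toFinset := by
      rw [Set.Finite.toFinset_subset_toFinset]
      exact F.ball_mono n.le_succ
    rw [← Finset.sum_sdiff hsub, Finset.sum_range_succ, add_comm, ← add_assoc]
    refine add_le_add ih ?_
    have hsphere : ∀ x ∈ (F.finite_ball (n + 1)).toFinset \ (F.finite_ball n).toFinset,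
        ((F.polyWeight β hβ).toFun x)⁻¹ ^ 2 = ((1 + ((n : ℝ) + 1)) ^ (2 * β))⁻¹ := by
      intro x hx
      rw [Finset.mem_sdiff, Set.Finite.mem_toFinset, Set.Finite.mem_toFinset, ← length_le_iff,
        ← length_le_iff] at hx
      have hl : F.length x = n + 1 := by omega
      simp only [polyWeight, hl]
      push_cast
      rw [inv_pow, ← Real.rpow_natCast, ← Real.rpow_mul (by positivity), mul_comm β]
      norm_num
    rw [Finset.sum_congr rfl hsphere, Finset.sum_const, Finset.card_sdiff_of_subset hsub,
      nsmul_eq_mul, Nat.cast_sub (Finset.card_le_card hsub), ← Set.ncard_eq_toFinset_card _ (F.finite_ball _),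
      ← Set.ncard_eq_toFinset_card _ (F.finite_ball _), growthTerm, div_eq_mul_inv]
    exact mul_le_mul_of_nonneg_right (hf.ncard_sub_ncard_le n) (by positivity)

theorem sum_inv_polyWeight_sq_le (hf : F.IsGrowthPair f lam) (β : ℝ) (hβ : 0 ≤ β)
    (hsum : Summable (growthTerm f lam β)) (X : Finset G) :
    ∑ x ∈ X, ((F.polyWeight β hβ).toFun x)⁻¹ ^ 2 ≤ 1 + ∑' n, growthTerm f lam β n := by
  have hX : X ⊆ (F.finite_ball (X.sup F.length)).toFinset := fun x hx => by
    rw [Set.Finite.mem_toFinset, ← length_le_iff]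
    exact Finset.le_sup hx
  refine (Finset.sum_le_sum_of_subset_of_nonneg hX fun _ _ _ => sq_nonneg _).trans
    ((hf.sum_ball_le β hβ _).trans ?_)
  gcongr
  exact hsum.sum_le_tsum _ fun n _ => hf.growthTerm_nonneg β n

end IsGrowthPair

end SymmGenSet

/-! ### Convergence of the series -/

open Filter Asymptotics in
theorem Polynomial.summable_eval_div_rpow {q : Polynomial ℝ} {e : ℕ} (hq : q.natDegree ≤ e) {s : ℝ}
    (hs : (e : ℝ) + 1 < s) :
    Summable fun n : ℕ => q.eval (n : ℝ) / (1 + ((n : ℝ) + 1)) ^ s := by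
  have h1 : (fun x : ℝ => q.eval x) =O[atTop] fun x => (Polynomial.X ^ e : Polynomial ℝ).eval x :=
    q.isBigO_atTop_of_degree_le _ (by
      rw [Polynomial.degree_X_pow]
      exact Polynomial.degree_le_of_natDegree_le hq)
  have h2 : (fun n : ℕ => q.eval (n : ℝ)) =O[atTop] fun n : ℕ => (n : ℝ) ^ e := by
    have h := h1.comp_tendsto tendsto_natCast_atTop_atTop
    simpa [Function.comp_def] using h
  have h3 : (fun n : ℕ => ((1 + ((n : ℝ) + 1)) ^ s)⁻¹) =O[atTop] fun n : ℕ => ((n : ℝ) ^ s)⁻¹ := by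
    refine IsBigO.of_bound 1 ((eventually_gt_atTop 0).mono fun n hn => ?_)
    have hn' : (0 : ℝ) < n := by exact_mod_cast hn
    rw [one_mul, Real.norm_of_nonneg (by positivity), Real.norm_of_nonneg (by positivity)]
    have : (0 : ℝ) ≤ s := by have : (0 : ℝ) ≤ e := by positivity
                             linarith
    gcongr
    linarith
  have h4 : Summable fun n : ℕ => (n : ℝ) ^ ((e : ℝ) - s) :=
    Real.summable_nat_rpow.2 (by linarith)
  refine summable_of_isBigO_nat h4 (((h2.mul h3).congr_left fun n => (div_eq_mul_inv _ _).symm).trans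
    (IsBigO.of_bound 1 ((eventually_gt_atTop 0).mono fun n hn => ?_)))
  have hn' : (0 : ℝ) < n := by exact_mod_cast hn
  rw [one_mul, Real.rpow_sub hn', Real.rpow_natCast, div_eq_mul_inv]

theorem summable_growthTerm_of_natDegree_le {f : Polynomial ℝ} {lam β : ℝ} {e : ℕ}
    (he : (Polynomial.taylor 1 f - Polynomial.C lam * f).natDegree ≤ e)
    (hβ : (e : ℝ) + 1 < 2 * β) : Summable (growthTerm f lam β) := by
  refine (Polynomial.summable_eval_div_rpow he hβ).congr fun n => ?_
  rw [growthTerm, Polynomial.eval_sub, Polynomial.taylor_eval, Polynomial.eval_mul,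
    Polynomial.eval_C]

theorem summable_growthTerm {f : Polynomial ℝ} {lam β : ℝ}
    (hβ : ((f.natDegree : ℝ) + 1) / 2 < β) : Summable (growthTerm f lam β) := by
  refine summable_growthTerm_of_natDegree_le (e := f.natDegree) ?_ (by linarith)
  refine (Polynomial.natDegree_sub_le _ _).trans (max_le (Polynomial.natDegree_taylor f 1).le ?_)
  exact Polynomial.natDegree_C_mul_le _ _

/-- For `lam = 1` the leading terms cancel. -/
theorem summable_growthTerm_one {f : Polynomial ℝ} {β : ℝ}
    (hβ : (f.natDegree : ℝ) / 2 < β) : Summable (growthTerm f 1 β) := by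
  rcases Nat.eq_zero_or_pos f.natDegree with h0 | hpos
  · refine summable_zero.congr fun n => ?_
    rw [Polynomial.eq_C_of_natDegree_eq_zero h0]
    simp [growthTerm]
  · refine summable_growthTerm_of_natDegree_le (e := f.natDegree - 1) ?_ ?_
    · rw [map_one, one_mul]
      have hf0 : f ≠ 0 := by rintro rfl; simp at hpos
      have hlt := Polynomial.degree_sub_lt_left (Polynomial.degree_taylor f 1)
        (by rwa [Ne, ← Polynomial.degree_eq_bot, Polynomial.degree_taylor, Polynomial.degree_eq_bot])
        (Polynomial.leadingCoeff_taylor 1 f)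
      rw [Polynomial.degree_taylor, Polynomial.degree_eq_natDegree hf0] at hlt
      rcases eq_or_ne (Polynomial.taylor 1 f - f) 0 with h | h
      · rw [h]; simp
      · rw [Polynomial.degree_eq_natDegree h] at hlt
        have : (Polynomial.taylor 1 f - f).natDegree < f.natDegree := by exact_mod_cast hlt
        omega
    · rw [Nat.cast_sub hpos]
      push_cast
      linarith

/-! ### The centre of a polynomially weighted group algebra -/

theorem corollaryT {G : Type*} [Group G] [Infinite G] (F : SymmGenSet G)
    (f : Polynomial ℝ) (lam : ℝ) (hf : F.IsGrowthPair f lam) (β : ℝ) (hβ : 0 ≤ β)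
    (h : (lam = 1 ∧ (F.growthOrder : ℝ) / 2 < β) ∨
      (lam < 1 ∧ ((F.growthOrder : ℝ) + 1) / 2 < β)) :
    IsIsomorphicToQAlgebra (AlgCenter (WeightedL1 (F.polyWeight β hβ))) ∧
    Summable (growthTerm f lam β) ∧
    SatisfiesVonNeumannInequality (AlgCenter (WeightedL1 (F.polyWeight β hβ)))
      (polyDelta f lam β) 1 := by
  have hsum : Summable (growthTerm f lam β) := by
    rw [← hf.natDegree_eq] at h
    rcases h with ⟨rfl, h⟩ | ⟨-, h⟩
    · exact summable_growthTerm_one h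
    · exact summable_growthTerm h
  set S := Real.sqrt (1 + ∑' n : ℕ, growthTerm f lam β n) with hS
  have hpos : 0 < 1 + ∑' n : ℕ, growthTerm f lam β n :=
    add_pos_of_pos_of_nonneg one_pos (tsum_nonneg fun n => hf.growthTerm_nonneg β n)
  have hD : 0 < max 1 ((2 : ℝ) ^ (β - 1)) := lt_max_of_lt_left one_pos
  have hinj := (WeightedL1.isInjectiveMulBound isGrothendieckBound_grothendieckConstant hD
    (Real.sqrt_pos.2 hpos) (F.polyWeight_mul_le β hβ) fun X => by
      rw [Real.sq_sqrt hpos.le]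
      exact hf.sum_inv_polyWeight_sq_le β hβ hsum X).algCenter
  rw [← hS, ← mul_assoc grothendieckConstant] at hinj
  have hC : 0 ≤ grothendieckConstant * max 1 ((2 : ℝ) ^ (β - 1)) * S :=
    mul_nonneg (mul_nonneg grothendieckConstant_nonneg hD.le) (Real.sqrt_nonneg _)
  have hVN : SatisfiesVonNeumannInequality (AlgCenter (WeightedL1 (F.polyWeight β hβ)))
      (polyDelta f lam β) 1 := hinj.satisfiesVonNeumannInequality hC
  have hδ : 0 < polyDelta f lam β :=
    mul_pos (by positivity) (inv_pos.2 (add_pos_of_pos_of_nonneg one_pos hC))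
  exact ⟨hVN.isIsomorphicToQAlgebra hδ, hsum, hVN⟩
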